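/- Let $p\ge 1$ be an integer, let $\mathrm{ReLU}^p(t)=(\max\{0,t\})^p$, and define $$G_p(x,y)=\int_{-1}^{1}\mathrm{ReLU}^p(z-x)\,\mathrm{ReLU}^p(z-y)\,dz,\qquad x,y\in[-1,1].$$ Let $\mathcal K_p$ be the integral operator on the real Hilbert space $L^2([-1,1])$ given by $$\mathcal K_p[h](x)=\int_{-1}^{1}G_p(x,y)\,h(y)\,dy .$$ Then $\mathcal K_p$ is compact; its eigenvalues are all positive and simple (each eigenspace is one-dimensional), and they form an infinite strictly decreasing sequence $\mu_{1,p}>\mu_{2,p}>\cdots>0$. Moreover, for each fixed $p$, $$\mu_{k,p}=O\bigl(k^{-(2p+2)}\bigr)\qquad\text{as }k\to\infty .$$ -/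

import Mathlib

open MeasureTheory Filter

noncomputable section

/-- The power ReLU activation `t ↦ (max {0, t}) ^ p`. -/
def reluPow (p : ℕ) (t : ℝ) : ℝ := (max 0 t) ^ p

/-- The kernel `G_p(x, y) = ∫_{-1}^{1} ReLU^p(z - x) ReLU^p(z - y) dz`. -/
def reluKernel (p : ℕ) (x y : ℝ) : ℝ :=
  ∫ z in (-1 : ℝ)..1, reluPow p (z - x) * reluPow p (z - y)

/-- Lebesgue measure on the interval `[-1, 1]`. -/
abbrev intervalMeasure : Measure ℝ := volume.restrict (Set.Icc (-1 : ℝ) 1)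

/-- The real Hilbert space `L²([-1, 1])`. -/
abbrev L2Interval : Type := Lp ℝ 2 intervalMeasure

/-- The integral `∫_{-1}^{1} G_p(x, y) h(y) dy`. -/
def reluIntegral (p : ℕ) (h : ℝ → ℝ) (x : ℝ) : ℝ :=
  ∫ y in (-1 : ℝ)..1, reluKernel p x y * h y

theorem reluIntegral_eq (p : ℕ) (h : ℝ → ℝ) (x : ℝ) :
    reluIntegral p h x = ∫ y, reluKernel p x y * h y ∂intervalMeasure := by
  rw [reluIntegral, intervalIntegral.integral_of_le (by norm_num), integral_Icc_eq_integral_Ioc]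

theorem continuous_reluPow (p : ℕ) : Continuous (reluPow p) := by
  unfold reluPow; fun_prop

theorem continuous_reluKernel (p : ℕ) : Continuous fun q : ℝ × ℝ => reluKernel p q.1 q.2 := by
  unfold reluKernel
  apply intervalIntegral.continuous_parametric_intervalIntegral_of_continuous'
  have := continuous_reluPow p
  simp only [Function.uncurry_def]
  fun_prop

theorem exists_reluKernel_bound (p : ℕ) :
    ∃ M : ℝ, 0 ≤ M ∧ ∀ x ∈ Set.Icc (-1 : ℝ) 1, ∀ y ∈ Set.Icc (-1 : ℝ) 1,
      ‖reluKernel p x y‖ ≤ M := by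
  obtain ⟨M, hM⟩ := ((isCompact_Icc (a := (-1 : ℝ)) (b := 1)).prod
    (isCompact_Icc (a := (-1 : ℝ)) (b := 1))).exists_bound_of_continuousOn
      (continuous_reluKernel p).continuousOn
  exact ⟨max M 0, le_max_right _ _, fun x hx y hy => (hM (x, y) ⟨hx, hy⟩).trans (le_max_left _ _)⟩

theorem integrable_reluKernel_mul (p : ℕ) (h : L2Interval) {x : ℝ}
    (hx : x ∈ Set.Icc (-1 : ℝ) 1) :
    Integrable (fun y => reluKernel p x y * h y) intervalMeasure := by
  obtain ⟨M, -, hM⟩ := exists_reluKernel_bound p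
  refine ((Lp.memLp h).integrable (by norm_num)).bdd_mul (c := M) ?_ ?_
  · exact ((continuous_reluKernel p).comp (Continuous.prodMk_right x)).aestronglyMeasurable
  · exact (ae_restrict_iff' measurableSet_Icc).2 (ae_of_all _ fun y hy => hM x hx y hy)

theorem norm_reluIntegral_le {p : ℕ} {M : ℝ}
    (hM : ∀ x ∈ Set.Icc (-1 : ℝ) 1, ∀ y ∈ Set.Icc (-1 : ℝ) 1, ‖reluKernel p x y‖ ≤ M)
    (h : L2Interval) {x : ℝ} (hx : x ∈ Set.Icc (-1 : ℝ) 1) :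
    ‖reluIntegral p h x‖ ≤ M * ∫ y, ‖h y‖ ∂intervalMeasure := by
  rw [reluIntegral_eq, ← integral_const_mul]
  refine norm_integral_le_of_norm_le
    (((Lp.memLp h).integrable (by norm_num)).norm.const_mul M) ?_
  refine (ae_restrict_iff' measurableSet_Icc).2 (ae_of_all _ fun y hy => ?_)
  rw [norm_mul]
  exact mul_le_mul_of_nonneg_right (hM x hx y hy) (norm_nonneg _)

theorem memLp_reluIntegral (p : ℕ) (h : L2Interval) :
    MemLp (reluIntegral p h) 2 intervalMeasure := by
  obtain ⟨M, -, hM⟩ := exists_reluKernel_bound p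
  refine MemLp.of_bound (C := M * ∫ y, ‖h y‖ ∂intervalMeasure) ?_ ?_
  · have : StronglyMeasurable
        (Function.uncurry fun x y : ℝ => reluKernel p x y * h y) :=
      (continuous_reluKernel p).stronglyMeasurable.mul
        ((Lp.stronglyMeasurable h).comp_measurable measurable_snd)
    have h2 := this.integral_prod_right (ν := intervalMeasure)
    simp only [← reluIntegral_eq] at h2
    exact h2.aestronglyMeasurable
  · exact (ae_restrict_iff' measurableSet_Icc).2
      (ae_of_all _ fun x hx => norm_reluIntegral_le hM h hx)

/-- `h ↦ ∫_{-1}^{1} G_p(·, y) h(y) dy` as a linear map on `L²([-1, 1])`. -/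
def reluLinearMap (p : ℕ) : L2Interval →ₗ[ℝ] L2Interval where
  toFun h := (memLp_reluIntegral p h).toLp (reluIntegral p h)
  map_add' f g := by
    rw [← MemLp.toLp_add, MemLp.toLp_eq_toLp_iff]
    refine (ae_restrict_iff' measurableSet_Icc).2 (ae_of_all _ fun x hx => ?_)
    simp only [Pi.add_apply, reluIntegral_eq]
    rw [← integral_add (integrable_reluKernel_mul p f hx) (integrable_reluKernel_mul p g hx)]
    refine integral_congr_ae ?_
    filter_upwards [Lp.coeFn_add f g] with y hy
    rw [hy, Pi.add_apply, mul_add]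
  map_smul' c f := by
    rw [RingHom.id_apply, ← MemLp.toLp_const_smul, MemLp.toLp_eq_toLp_iff]
    refine ae_of_all _ fun x => ?_
    simp only [Pi.smul_apply, reluIntegral_eq, smul_eq_mul]
    rw [← integral_const_mul]
    refine integral_congr_ae ?_
    filter_upwards [Lp.coeFn_smul c f] with y hy
    rw [hy, Pi.smul_apply, smul_eq_mul]
    ring

theorem exists_reluLinearMap_bound (p : ℕ) :
    ∃ C : ℝ, ∀ h : L2Interval, ‖reluLinearMap p h‖ ≤ C * ‖h‖ := by
  obtain ⟨M, hM0, hM⟩ := exists_reluKernel_bound p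
  set V := intervalMeasure.real Set.univ
  refine ⟨V ^ (1 / 2 : ℝ) * (M * V ^ (1 / 2 : ℝ)), fun h => ?_⟩
  have h1 : ∫ y, ‖h y‖ ∂intervalMeasure ≤ ‖h‖ * V ^ (1 / 2 : ℝ) := by
    have e := eLpNorm_le_eLpNorm_mul_rpow_measure_univ (μ := intervalMeasure) (p := 1) (q := 2)
      (by norm_num) (Lp.aestronglyMeasurable h)
    have hfin : eLpNorm h 2 intervalMeasure * intervalMeasure Set.univ ^
        (1 / (1 : ENNReal).toReal - 1 / (2 : ENNReal).toReal) ≠ ⊤ :=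
      ENNReal.mul_ne_top (Lp.memLp h).2.ne
        (ENNReal.rpow_ne_top_of_nonneg (by norm_num) (measure_ne_top _ _))
    have e2 := ENNReal.toReal_mono hfin e
    rw [ENNReal.toReal_mul, ← ENNReal.toReal_rpow, ← Lp.norm_def] at e2
    rw [integral_norm_eq_lintegral_enorm (Lp.aestronglyMeasurable h),
      ← eLpNorm_one_eq_lintegral_enorm]
    refine e2.trans (le_of_eq ?_)
    congr 2
    norm_num
  have h2 : ‖reluLinearMap p h‖ ≤
      V ^ (1 / 2 : ℝ) * (M * ∫ y, ‖h y‖ ∂intervalMeasure) := by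
    have := Lp.norm_le_of_ae_bound (f := reluLinearMap p h)
      (C := M * ∫ y, ‖h y‖ ∂intervalMeasure)
      (mul_nonneg hM0 (integral_nonneg fun _ => norm_nonneg _)) (by
        filter_upwards [(memLp_reluIntegral p h).coeFn_toLp,
          ae_restrict_mem (measurableSet_Icc (a := (-1 : ℝ)) (b := 1))] with x hx hx'
        change ‖((memLp_reluIntegral p h).toLp (reluIntegral p h)) x‖ ≤ _
        rw [hx]
        exact norm_reluIntegral_le hM h hx')
    refine this.trans (le_of_eq ?_)
    have hT : (ENNReal.toReal 2)⁻¹ = (1 / 2 : ℝ) := by norm_num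
    rw [hT]
    rfl
  refine h2.trans ?_
  have hV : 0 ≤ V ^ (1 / 2 : ℝ) := by positivity
  calc V ^ (1 / 2 : ℝ) * (M * ∫ y, ‖h y‖ ∂intervalMeasure)
      ≤ V ^ (1 / 2 : ℝ) * (M * (‖h‖ * V ^ (1 / 2 : ℝ))) := by gcongr
    _ = _ := by ring

/-- The integral operator `K_p[h](x) = ∫_{-1}^{1} G_p(x, y) h(y) dy`, as a bounded operator on
`L²([-1, 1])`. -/
def reluOperator (p : ℕ) : L2Interval →L[ℝ] L2Interval where
  toLinearMap := reluLinearMap p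
  cont := by
    obtain ⟨C, hC⟩ := exists_reluLinearMap_bound p
    exact AddMonoidHomClass.continuous_of_bound (reluLinearMap p) C hC

theorem coeFn_reluOperator (p : ℕ) (h : L2Interval) :
    reluOperator p h =ᵐ[intervalMeasure]
      fun x => ∫ y in (-1 : ℝ)..1, reluKernel p x y * h y :=
  (memLp_reluIntegral p h).coeFn_toLp

end

/-! Fubini factors the operator as `K = VᵗV`, where `V` is `reluTransform` and its transpose is
`reluCotransform`. By Cauchy's formula, on `[-1, 1]` `V` is `p!` times `n = p + 1` integrations from
`-1`, and `Vᵗ` the same from `1`. Thus `⟪K f, f⟫ = ‖V f‖²`. Since `V` is injective (test against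
derivatives of bump functions), all eigenvalues are positive.

Simplicity: if `K h = c h`, then `u = K h` solves `u^(2n) = const · u`, with `u^(j)(1) = 0` for `j <
n` and `u^(j)(-1) = 0` for `n ≤ j < 2n`. If also `u^(n)(1) = 0`, that is `V h(1) = 0`, then counting
signs around the cycle `u → u' → ... → u^(2n)` gains one alternation per turn, while a nonzero
solution has boundedly many (`eq_zero_of_clamped_free`). So `h ↦ V h(1)` is injective on each
eigenspace.

Decay and compactness: cut `[-1, 1]` into `N` equal pieces. If `f` is orthogonal to the polynomials
of degree at most `p` on every piece, then `V f` on a piece depends only on `f` there, and `‖V f‖² ≤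
(2/N)^(2p+2) ‖f‖²`. These are `(p+1)N` linear conditions, so at most `(p+1)N` eigenvalues exceed
`(2/N)^(2p+2)`; the same estimate makes `K` a norm limit of finite-rank operators. The spectral
theorem then supplies infinitely many eigenvalues. -/

/-! ### Sign alternations of successive derivatives -/

/-- `f` takes values of alternating strict sign at `m` increasing points of `[a, b]`. -/
def AlternatesOn (f : ℝ → ℝ) (a b : ℝ) (m : ℕ) : Prop :=
  ∃ (x : ℕ → ℝ) (ε : ℝ), (∀ i < m, x i ∈ Set.Icc a b) ∧ (∀ i, i + 1 < m → x i < x (i + 1)) ∧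
    ∀ i < m, 0 < ε * (-1) ^ i * f (x i)

namespace AlternatesOn

variable {f F : ℝ → ℝ} {a b : ℝ} {m : ℕ}

theorem of_eqOn_mul {g : ℝ → ℝ} {c : ℝ} (h : AlternatesOn f a b m)
    (hfg : ∀ x ∈ Set.Icc a b, f x = c * g x) : AlternatesOn g a b m := by
  obtain ⟨x, ε, hx, hlt, hs⟩ := h
  refine ⟨x, ε * c, hx, hlt, fun i hi => ?_⟩
  have := hs i hi
  rw [hfg _ (hx i hi)] at this
  linarith

/-- If the increments of `F` along an increasing sequence alternate in sign, so does `F'`. -/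
theorem of_increments (hF : ∀ x, HasDerivAt F (f x) x) (t : ℕ → ℝ) (ε : ℝ)
    (ht : ∀ i ≤ m, t i ∈ Set.Icc a b) (hle : ∀ i < m, t i ≤ t (i + 1))
    (hs : ∀ i < m, 0 < ε * (-1) ^ i * (F (t (i + 1)) - F (t i))) : AlternatesOn f a b m := by
  have key : ∀ i, ∃ y, i < m → y ∈ Set.Ioo (t i) (t (i + 1)) ∧ 0 < ε * (-1) ^ i * f y := by
    intro i
    by_cases hi : i < m
    · have hlt : t i < t (i + 1) := by
        refine lt_of_le_of_ne (hle i hi) fun h => ?_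
        have := hs i hi
        rw [h] at this
        simp at this
      obtain ⟨y, hy, he⟩ := exists_hasDerivAt_eq_slope F f hlt
        (fun x _ => (hF x).continuousAt.continuousWithinAt) (fun x _ => hF x)
      refine ⟨y, fun _ => ⟨hy, ?_⟩⟩
      rw [he, ← mul_div_assoc]
      exact div_pos (hs i hi) (sub_pos.2 hlt)
    · exact ⟨0, fun h => absurd h hi⟩
  choose y hy using key
  refine ⟨y, ε, fun i hi => ?_, fun i hi => ?_, fun i hi => (hy i hi).2⟩
  · exact ⟨(ht i hi.le).1.trans (hy i hi).1.1.le, (hy i hi).1.2.le.trans (ht (i + 1) hi).2⟩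
  · exact (hy i (by omega)).1.2.trans (hy (i + 1) hi).1.1

theorem sign_increment {ε u v : ℝ} (i : ℕ) (hu : 0 < ε * (-1) ^ i * u)
    (hv : 0 < ε * (-1) ^ (i + 1) * v) : 0 < ε * (-1) ^ (i + 1) * (v - u) := by
  rw [pow_succ] at *
  nlinarith

theorem deriv_succ (hF : ∀ x, HasDerivAt F (f x) x) (h : AlternatesOn F a b (m + 1)) :
    AlternatesOn f a b m := by
  obtain ⟨x, ε, hx, hlt, hs⟩ := h
  refine of_increments hF x (-ε) (fun i hi => hx i (by omega))
    (fun i hi => (hlt i (by omega)).le) fun i hi => ?_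
  have := sign_increment i (hs i (by omega)) (hs (i + 1) (by omega))
  rw [pow_succ] at this
  linarith

/-- The zero at `a` serves as an extra node in front, which compensates for the alternation that
Rolle's argument loses in `deriv_succ`. -/
theorem deriv_of_left (hF : ∀ x, HasDerivAt F (f x) x) (ha : F a = 0) (h : AlternatesOn F a b m) :
    AlternatesOn f a b m := by
  obtain rfl | hm := Nat.eq_zero_or_pos m
  · exact ⟨fun _ => 0, 0, by simp⟩
  obtain ⟨x, ε, hx, hlt, hs⟩ := h
  have hab : a ≤ b := (hx 0 hm).1.trans (hx 0 hm).2
  refine of_increments hF (fun i => Nat.casesOn i a x) ε ?_ ?_ ?_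
  · rintro (_ | i) hi
    · exact ⟨le_rfl, hab⟩
    · exact hx i hi
  · rintro (_ | i) hi
    · exact (hx 0 hm).1
    · exact (hlt i hi).le
  · rintro (_ | i) hi
    · simpa [ha] using hs 0 hm
    · exact sign_increment i (hs i (by omega)) (hs (i + 1) hi)

theorem deriv_of_right (hF : ∀ x, HasDerivAt F (f x) x) (hb : F b = 0)
    (h : AlternatesOn F a b m) : AlternatesOn f a b m := by
  obtain rfl | hm := Nat.eq_zero_or_pos m
  · exact ⟨fun _ => 0, 0, by simp⟩
  obtain ⟨x, ε, hx, hlt, hs⟩ := h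
  have hab : a ≤ b := (hx 0 hm).1.trans (hx 0 hm).2
  refine of_increments hF (fun i => if i < m then x i else b) (-ε) ?_ ?_ ?_
  · intro i hi
    split_ifs with h
    exacts [hx i h, ⟨hab, le_rfl⟩]
  · intro i hi
    simp only [hi, if_true]
    split_ifs with h
    exacts [(hlt i h).le, (hx i hi).2]
  · intro i hi
    simp only [hi, if_true]
    split_ifs with h
    · have := sign_increment i (hs i (by omega)) (hs (i + 1) (by omega))
      rw [pow_succ] at this
      linarith
    · have := hs i hi
      rw [hb]
      linarith

/-- Zeros at both ends add two nodes, a net gain of one. This is the only gain in the sign count; `0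
< m` excludes `F = 0`. -/
theorem deriv_of_left_right (hF : ∀ x, HasDerivAt F (f x) x) (ha : F a = 0) (hb : F b = 0)
    (hm : 0 < m) (h : AlternatesOn F a b m) : AlternatesOn f a b (m + 1) := by
  obtain ⟨x, ε, hx, hlt, hs⟩ := h
  have hab : a ≤ b := (hx 0 hm).1.trans (hx 0 hm).2
  refine of_increments hF (fun i => Nat.casesOn i a fun i => if i < m then x i else b) ε ?_ ?_ ?_
  · rintro (_ | i) hi
    · exact ⟨le_rfl, hab⟩
    · dsimp only
      split_ifs with h
      exacts [hx i h, ⟨hab, le_rfl⟩]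
  · rintro (_ | i) hi
    · simpa [hm] using (hx 0 hm).1
    · have hi' : i < m := by omega
      simp only [hi', if_true]
      split_ifs with h
      exacts [(hlt i h).le, (hx i hi').2]
  · rintro (_ | i) hi
    · simpa [ha, hm] using hs 0 hm
    · have hi' : i < m := by omega
      simp only [hi', if_true]
      split_ifs with h
      · exact sign_increment i (hs i (by omega)) (hs (i + 1) h)
      · have := hs i hi'
        rw [hb, pow_succ]
        linarith

theorem exists_zero (hf : Continuous f) (hm : 2 ≤ m) (h : AlternatesOn f a b m) :
    ∃ x ∈ Set.Icc a b, f x = 0 := by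
  obtain ⟨x, ε, hx, hlt, hs⟩ := h
  have h0 := hs 0 (by omega)
  have h1 := hs 1 (by omega)
  have hsub : Set.Icc (x 0) (x 1) ⊆ Set.Icc a b :=
    Set.Icc_subset_Icc (hx 0 (by omega)).1 (hx 1 (by omega)).2
  have hle : x 0 ≤ x 1 := (hlt 0 (by omega)).le
  have hε : ε ≠ 0 := by rintro rfl; simp at h0
  obtain ⟨z, hz, he⟩ := intermediate_value_Icc' (f := fun y => ε * f y) hle
    (by fun_prop) (show (0 : ℝ) ∈ _ from ⟨by linarith, by linarith⟩)
  exact ⟨z, hsub hz, by simpa [hε] using he⟩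

end AlternatesOn

/-- Sup-norm bound along a chain of derivatives each of which vanishes somewhere in `[a, b]`. -/
theorem abs_le_of_deriv_chain {u : ℕ → ℝ → ℝ} {M : ℕ} {a b B : ℝ}
    (hu : ∀ j < M, ∀ x, HasDerivAt (u j) (u (j + 1) x) x)
    (hz : ∀ j < M, ∃ x ∈ Set.Icc a b, u j x = 0) (hB : ∀ x ∈ Set.Icc a b, |u M x| ≤ B) :
    ∀ x ∈ Set.Icc a b, |u 0 x| ≤ B * (b - a) ^ M := by
  induction M generalizing B with
  | zero => simpa using hB
  | succ M ih =>
    intro x hx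
    have hab : a ≤ b := hx.1.trans hx.2
    have hB0 : 0 ≤ B := (abs_nonneg _).trans (hB x hx)
    have := ih (B := B * (b - a)) (fun j hj => hu j (by omega)) (fun j hj => hz j (by omega))
      (fun y hy => ?_) x hx
    · rw [pow_succ']
      linarith
    obtain ⟨z, hz, h0⟩ := hz M (by omega)
    have := (convex_Icc a b).norm_image_sub_le_of_norm_hasDerivWithin_le (C := B)
      (fun w _ => (hu M (by omega) w).hasDerivWithinAt) hB hz hy
    rw [h0, sub_zero, Real.norm_eq_abs, Real.norm_eq_abs] at this
    refine this.trans (mul_le_mul_of_nonneg_left ?_ hB0)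
    rw [abs_le]
    constructor <;> linarith [hz.1, hz.2, hy.1, hy.2]

/-- A nonzero solution of `u^(M) = c u` has finitely many sign changes. -/
theorem exists_not_alternatesOn {u : ℕ → ℝ → ℝ} {M : ℕ} {c : ℝ} (hM : 0 < M)
    (hu : ∀ j < M, ∀ x, HasDerivAt (u j) (u (j + 1) x) x)
    (hc : ∀ x ∈ Set.Icc (-1 : ℝ) 1, u M x = c * u 0 x) :
    ∃ m, ¬ AlternatesOn (u 0) (-1) 1 m := by
  -- This size gives `2 / N ≤ 1` and `|c| * (2 / N) < 1`. By pigeonhole, one of `N` blocks of `M`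
  -- consecutive steps has length at most `2 / N`.
  obtain ⟨N, hN⟩ := exists_nat_gt (2 * (|c| + 1))
  have hc0 := abs_nonneg c
  have hN0 : (0 : ℝ) < N := by linarith
  refine ⟨N * M + 1, fun ⟨x, ε, hx, hlt, hs⟩ => ?_⟩
  obtain ⟨i, hi, hd⟩ : ∃ i < N, x ((i + 1) * M) - x (i * M) ≤ 2 / N := by
    by_contra! hcon
    have h1 : ∑ i ∈ Finset.range N, (x ((i + 1) * M) - x (i * M)) = x (N * M) - x 0 := by
      rw [Finset.sum_range_sub (fun i => x (i * M))]; simp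
    have h2 : ∑ i ∈ Finset.range N, (2 / N : ℝ) <
        ∑ i ∈ Finset.range N, (x ((i + 1) * M) - x (i * M)) := by
      refine Finset.sum_lt_sum_of_nonempty ?_ fun i hi => hcon i (Finset.mem_range.1 hi)
      rw [Finset.nonempty_range_iff]
      rintro rfl
      simp at hN0
    rw [h1, Finset.sum_const, Finset.card_range, nsmul_eq_mul, mul_div_cancel₀ _ hN0.ne'] at h2
    have h3 := (hx (N * M) (by omega)).2
    have h4 := (hx 0 (by omega)).1
    linarith
  set a := x (i * M) with ha
  set b := x ((i + 1) * M) with hb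
  have hiN : (i + 1) * M ≤ N * M := Nat.mul_le_mul_right _ hi
  have hexp : (i + 1) * M = i * M + M := by ring
  have hmono : ∀ k, ∀ j, j + k ≤ N * M → x j ≤ x (j + k) := by
    intro k
    induction k with
    | zero => simp
    | succ k ih => exact fun j hj => (ih j (by omega)).trans (hlt (j + k) (by omega)).le
  have hsub : Set.Icc a b ⊆ Set.Icc (-1) 1 :=
    Set.Icc_subset_Icc (hx _ (by omega)).1 (hx _ (by omega)).2
  have halt : AlternatesOn (u 0) a b (M + 1) := by
    refine ⟨fun k => x (i * M + k), ε * (-1) ^ (i * M), fun k hk => ⟨hmono _ _ (by omega), ?_⟩,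
      fun k hk => hlt _ (by omega), fun k hk => ?_⟩
    · have := hmono (M - k) (i * M + k) (by omega)
      rwa [show i * M + k + (M - k) = (i + 1) * M by omega] at this
    · have := hs (i * M + k) (by omega)
      rwa [pow_add, ← mul_assoc] at this
  -- For `j < M` at least two alternations remain, so every `u j` has a zero in the short block.
  have hall : ∀ j ≤ M, AlternatesOn (u j) a b (M + 1 - j) := by
    intro j
    induction j with
    | zero => exact fun _ => halt
    | succ j ih =>
      intro hj
      have h := ih (by omega)
      rw [show M + 1 - j = M + 1 - (j + 1) + 1 by omega] at h
      exact h.deriv_succ (hu j (by omega))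
  have hcont : ∀ j < M, Continuous (u j) := fun j hj =>
    continuous_iff_continuousAt.2 fun x => (hu j hj x).continuousAt
  have hab : a ≤ b := by
    have := hmono M (i * M) (by omega)
    rwa [← hexp] at this
  obtain ⟨z, hz, hmax⟩ := isCompact_Icc.exists_isMaxOn (Set.nonempty_Icc.2 hab)
    (hcont 0 hM).abs.continuousOn
  -- At the maximum `z` of `|u 0|` on the block this reads `|u 0 z| ≤ |c| (b - a)^M |u 0 z|`, whose
  -- factor is below `1`.
  have hbound := abs_le_of_deriv_chain hu
    (fun j hj => (hall j hj.le).exists_zero (hcont j hj) (by omega)) (B := |c| * |u 0 z|)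
    (fun y hy => by
      rw [hc y (hsub hy), abs_mul]
      exact mul_le_mul_of_nonneg_left (hmax hy) hc0) z hz
  have hpos : 0 < |u 0 z| := by
    have h1 : |u 0 a| ≤ |u 0 z| := hmax ⟨le_rfl, hab⟩
    have h2 := hs (i * M) (by omega)
    refine lt_of_lt_of_le (abs_pos.2 fun h => ?_) h1
    rw [← ha, h] at h2
    simp at h2
  have h2N : 2 / (N : ℝ) ≤ 1 := by rw [div_le_one hN0]; linarith
  have hpow : (b - a) ^ M ≤ 2 / N :=
    calc (b - a) ^ M ≤ (2 / N : ℝ) ^ M := pow_le_pow_left₀ (by linarith) hd M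
      _ ≤ (2 / N : ℝ) ^ 1 := pow_le_pow_of_le_one (by positivity) h2N hM
      _ = 2 / N := pow_one _
  have hlt1 : |c| * (2 / N) < 1 := by
    rw [← mul_div_assoc, div_lt_one hN0]
    linarith
  have : |c| * (b - a) ^ M < 1 := (mul_le_mul_of_nonneg_left hpow hc0).trans_lt hlt1
  nlinarith

/-- Uniqueness for the clamped-free problem `u^(2n) = c u` with one additional boundary
condition. -/
theorem eq_zero_of_clamped_free {u : ℕ → ℝ → ℝ} {n : ℕ} {c : ℝ} (hn : 0 < n)
    (hu : ∀ j < 2 * n, ∀ x, HasDerivAt (u j) (u (j + 1) x) x)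
    (hc : ∀ x ∈ Set.Icc (-1 : ℝ) 1, u (2 * n) x = c * u 0 x)
    (hright : ∀ j ≤ n, u j 1 = 0) (hleft : ∀ j, n ≤ j → j < 2 * n → u j (-1) = 0) :
    ∀ x ∈ Set.Icc (-1 : ℝ) 1, u 0 x = 0 := by
  by_contra! hcon
  obtain ⟨z, hz, hne⟩ := hcon
  obtain ⟨m, hm⟩ := exists_not_alternatesOn (by omega) hu hc
  -- One turn of the cycle: up to `u n` the zeros at `1` preserve the count, `u n` vanishes at both
  -- ends and yields one more, the zeros at `-1` preserve it up to `u (2 * n)`, which is `c * u 0`.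
  have hall : ∀ m, AlternatesOn (u 0) (-1) 1 (m + 1) := by
    intro m
    induction m with
    | zero =>
      refine ⟨fun _ => z, u 0 z, fun _ _ => hz, fun i hi => by omega, fun i hi => ?_⟩
      obtain rfl : i = 0 := by omega
      simpa using mul_self_pos.2 hne
    | succ m ih =>
      have h1 : ∀ j ≤ n, AlternatesOn (u j) (-1) 1 (m + 1) := by
        intro j
        induction j with
        | zero => exact fun _ => ih
        | succ j ihj =>
          exact fun hj => (ihj (by omega)).deriv_of_right (hu j (by omega)) (hright j (by omega))
      have h2 : ∀ j, n + 1 + j ≤ 2 * n → AlternatesOn (u (n + 1 + j)) (-1) 1 (m + 2) := by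
        intro j
        induction j with
        | zero =>
          exact fun _ => (h1 n le_rfl).deriv_of_left_right (hu n (by omega))
            (hleft n le_rfl (by omega)) (hright n le_rfl) (by omega)
        | succ j ihj =>
          exact fun hj => (ihj (by omega)).deriv_of_left (hu (n + 1 + j) (by omega))
            (hleft _ (by omega) (by omega))
      have h3 := h2 (n - 1) (by omega)
      rw [show n + 1 + (n - 1) = 2 * n by omega] at h3
      exact h3.of_eqOn_mul hc
  obtain _ | m := m
  · exact hm ⟨fun _ => 0, 0, by simp⟩
  · exact hm (hall m)

/-! ### Continuous kernels and the factorization of the operator -/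

section ContinuousKernel

variable {b : ℝ → ℝ → ℝ} {f g : ℝ → ℝ}

theorem exists_norm_kernel_le (hb : Continuous fun q : ℝ × ℝ => b q.1 q.2) (r s : ℝ) :
    ∃ M, ∀ x ∈ Set.Icc r s, ∀ y ∈ Set.Icc (-1 : ℝ) 1, ‖b x y‖ ≤ M := by
  obtain ⟨M, hM⟩ := ((isCompact_Icc (a := r) (b := s)).prod
    (isCompact_Icc (a := (-1 : ℝ)) (b := 1))).exists_bound_of_continuousOn hb.continuousOn
  exact ⟨M, fun x hx y hy => hM (x, y) ⟨hx, hy⟩⟩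

theorem ae_mem_Icc : ∀ᵐ x ∂intervalMeasure, x ∈ Set.Icc (-1 : ℝ) 1 :=
  ae_restrict_mem measurableSet_Icc

theorem integral_intervalMeasure (f : ℝ → ℝ) :
    ∫ x, f x ∂intervalMeasure = ∫ x in (-1 : ℝ)..1, f x := by
  rw [intervalIntegral.integral_of_le (by norm_num), integral_Icc_eq_integral_Ioc]

theorem Continuous.integrable_intervalMeasure (hf : Continuous f) :
    Integrable f intervalMeasure :=
  hf.continuousOn.integrableOn_compact isCompact_Icc

theorem Continuous.integrable_mul_intervalMeasure (hg : Continuous g)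
    (hf : Integrable f intervalMeasure) : Integrable (fun y => g y * f y) intervalMeasure := by
  obtain ⟨M, hM⟩ := isCompact_Icc.exists_bound_of_continuousOn
    (hg.continuousOn (s := Set.Icc (-1 : ℝ) 1))
  refine hf.bdd_mul (c := M) hg.aestronglyMeasurable ?_
  filter_upwards [ae_mem_Icc] with y hy using hM y hy

theorem continuous_integral_kernel (hb : Continuous fun q : ℝ × ℝ => b q.1 q.2)
    (hf : Integrable f intervalMeasure) :
    Continuous fun x => ∫ y, b x y * f y ∂intervalMeasure := by
  refine continuous_iff_continuousAt.2 fun x₀ => ?_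
  obtain ⟨M, hM⟩ := exists_norm_kernel_le hb (x₀ - 1) (x₀ + 1)
  refine continuousAt_of_dominated (bound := fun y => M * ‖f y‖) ?_ ?_ (hf.norm.const_mul M) ?_
  · exact Eventually.of_forall fun x =>
      ((hb.comp (Continuous.prodMk_right x)).integrable_mul_intervalMeasure hf).1
  · filter_upwards [Icc_mem_nhds (show x₀ - 1 < x₀ by linarith) (show x₀ < x₀ + 1 by linarith)]
      with x hx
    filter_upwards [ae_mem_Icc] with y hy
    rw [norm_mul]
    exact mul_le_mul_of_nonneg_right (hM x hx y hy) (norm_nonneg _)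
  · refine Eventually.of_forall fun y => ?_
    have : Continuous fun x => b x y := hb.comp (Continuous.prodMk_left y)
    exact (this.mul continuous_const).continuousAt

/-- Fubini's theorem for a continuous kernel and integrable densities. -/
theorem integral_kernel_swap (hb : Continuous fun q : ℝ × ℝ => b q.1 q.2)
    (hf : Integrable f intervalMeasure) (hg : Integrable g intervalMeasure) :
    ∫ x, g x * ∫ y, b x y * f y ∂intervalMeasure ∂intervalMeasure =
      ∫ y, f y * ∫ x, b x y * g x ∂intervalMeasure ∂intervalMeasure := by
  obtain ⟨M, hM⟩ := exists_norm_kernel_le hb (-1) 1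
  have hint : Integrable (fun q : ℝ × ℝ => b q.1 q.2 * (g q.1 * f q.2))
      (intervalMeasure.prod intervalMeasure) := by
    refine (hg.mul_prod hf).bdd_mul (c := M) hb.aestronglyMeasurable ?_
    have h1 : ∀ᵐ q ∂(intervalMeasure.prod intervalMeasure),
        q ∈ Set.Icc (-1 : ℝ) 1 ×ˢ Set.Icc (-1 : ℝ) 1 := by
      rw [Measure.prod_restrict]
      exact ae_restrict_mem (measurableSet_Icc.prod measurableSet_Icc)
    filter_upwards [h1] with q hq using hM _ hq.1 _ hq.2
  have h := integral_integral_swap (f := fun x y => b x y * (g x * f y)) hint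
  simp only [← integral_const_mul]
  calc _ = ∫ x, ∫ y, b x y * (g x * f y) ∂intervalMeasure ∂intervalMeasure := by
        congr! 4; ring
    _ = _ := h
    _ = _ := by congr! 4; ring

end ContinuousKernel

/-- The factor `h ↦ ∫ ReLU^p(z - x) h(x) dx` of the integral operator. -/
noncomputable def reluTransform (p : ℕ) (h : ℝ → ℝ) (z : ℝ) : ℝ :=
  ∫ x, reluPow p (z - x) * h x ∂intervalMeasure

/-- The transpose `g ↦ ∫ ReLU^p(z - x) g(z) dz` of `reluTransform`. -/
noncomputable def reluCotransform (p : ℕ) (g : ℝ → ℝ) (x : ℝ) : ℝ :=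
  ∫ z, reluPow p (z - x) * g z ∂intervalMeasure

section Factorization

variable {p : ℕ} {f g : ℝ → ℝ}

theorem continuous_reluPow_sub (p : ℕ) : Continuous fun q : ℝ × ℝ => reluPow p (q.1 - q.2) :=
  (continuous_reluPow p).comp (by fun_prop)

theorem continuous_reluPow_sub' (p : ℕ) : Continuous fun q : ℝ × ℝ => reluPow p (q.2 - q.1) :=
  (continuous_reluPow p).comp (by fun_prop)

theorem continuous_reluTransform (hf : Integrable f intervalMeasure) :
    Continuous (reluTransform p f) :=
  continuous_integral_kernel (b := fun z x => reluPow p (z - x)) (continuous_reluPow_sub p) hf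

theorem continuous_reluCotransform (hf : Integrable f intervalMeasure) :
    Continuous (reluCotransform p f) :=
  continuous_integral_kernel (b := fun x z => reluPow p (z - x)) (continuous_reluPow_sub' p) hf

theorem integral_mul_reluCotransform (hf : Integrable f intervalMeasure)
    (hg : Integrable g intervalMeasure) :
    ∫ x, g x * reluCotransform p f x ∂intervalMeasure =
      ∫ z, f z * reluTransform p g z ∂intervalMeasure :=
  integral_kernel_swap (b := fun x z => reluPow p (z - x)) (continuous_reluPow_sub' p) hf hg

theorem reluIntegral_eq_cotransform (hf : Integrable f intervalMeasure) (x : ℝ) :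
    reluIntegral p f x = reluCotransform p (reluTransform p f) x := by
  have hx : Continuous fun z => reluPow p (z - x) := (continuous_reluPow p).comp (by fun_prop)
  have h := integral_kernel_swap (b := fun z y => reluPow p (z - y)) (continuous_reluPow_sub p) hf
    hx.integrable_intervalMeasure
  rw [reluIntegral_eq]
  unfold reluCotransform reluTransform
  rw [h]
  refine integral_congr_ae (ae_of_all _ fun y => ?_)
  simp only [reluKernel]
  rw [← integral_intervalMeasure, mul_comm]
  congr! 3
  ring

theorem continuous_reluIntegral (hf : Integrable f intervalMeasure) :
    Continuous (reluIntegral p f) := by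
  rw [funext (reluIntegral_eq_cotransform hf)]
  exact continuous_reluCotransform (continuous_reluTransform hf).integrable_intervalMeasure

theorem integral_mul_reluIntegral (hf : Integrable f intervalMeasure)
    (hg : Integrable g intervalMeasure) :
    ∫ x, g x * reluIntegral p f x ∂intervalMeasure =
      ∫ z, reluTransform p f z * reluTransform p g z ∂intervalMeasure := by
  simp only [reluIntegral_eq_cotransform hf]
  exact integral_mul_reluCotransform (continuous_reluTransform hf).integrable_intervalMeasure hg

theorem integrable_coeFn (h : L2Interval) : Integrable h intervalMeasure :=
  (Lp.memLp h).integrable (by norm_num)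

-- The form is an inner product of transforms; symmetry, positivity and the Cauchy-Schwarz
-- inequality for `reluOperator` all follow from this.
open scoped InnerProductSpace in
theorem inner_reluOperator (p : ℕ) (f g : L2Interval) :
    ⟪reluOperator p f, g⟫_ℝ = ∫ z, reluTransform p f z * reluTransform p g z ∂intervalMeasure := by
  rw [← integral_mul_reluIntegral (integrable_coeFn f) (integrable_coeFn g), L2.inner_def]
  refine integral_congr_ae ?_
  filter_upwards [coeFn_reluOperator p f] with x hx
  rw [hx]
  rfl

theorem isSymmetric_reluOperator (p : ℕ) :
    (reluOperator p : L2Interval →ₗ[ℝ] L2Interval).IsSymmetric := by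
  intro f g
  rw [ContinuousLinearMap.coe_coe, real_inner_comm, real_inner_comm, inner_reluOperator,
    real_inner_comm, inner_reluOperator]
  simp only [mul_comm]

end Factorization

/-! ### Repeated primitives from the two endpoints -/

/-- The integral of `f` from the left endpoint of `[-1, 1]`. -/
noncomputable def leftPrimitive (f : ℝ → ℝ) (z : ℝ) : ℝ := ∫ t in (-1 : ℝ)..z, f t

/-- The integral of `f` to the right endpoint of `[-1, 1]`. -/
noncomputable def rightPrimitive (f : ℝ → ℝ) (x : ℝ) : ℝ := ∫ t in x..1, f t

section Primitive

variable {p : ℕ} {f : ℝ → ℝ}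

theorem hasDerivAt_leftPrimitive (hf : Continuous f) (z : ℝ) :
    HasDerivAt (leftPrimitive f) (f z) z :=
  intervalIntegral.integral_hasDerivAt_right (hf.intervalIntegrable _ _)
    hf.stronglyMeasurable.stronglyMeasurableAtFilter hf.continuousAt

theorem hasDerivAt_rightPrimitive (hf : Continuous f) (x : ℝ) :
    HasDerivAt (rightPrimitive f) (-f x) x :=
  intervalIntegral.integral_hasDerivAt_left (hf.intervalIntegrable _ _)
    hf.stronglyMeasurable.stronglyMeasurableAtFilter hf.continuousAt

theorem continuous_leftPrimitive (hf : Continuous f) : Continuous (leftPrimitive f) :=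
  continuous_iff_continuousAt.2 fun z => (hasDerivAt_leftPrimitive hf z).continuousAt

theorem continuous_rightPrimitive (hf : Continuous f) : Continuous (rightPrimitive f) :=
  continuous_iff_continuousAt.2 fun z => (hasDerivAt_rightPrimitive hf z).continuousAt

theorem continuous_leftPrimitive_iterate (hf : Continuous f) (k : ℕ) :
    Continuous (leftPrimitive^[k] f) := by
  induction k with
  | zero => exact hf
  | succ k ih => rw [Function.iterate_succ_apply']; exact continuous_leftPrimitive ih

theorem continuous_rightPrimitive_iterate (hf : Continuous f) (k : ℕ) :
    Continuous (rightPrimitive^[k] f) := by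
  induction k with
  | zero => exact hf
  | succ k ih => rw [Function.iterate_succ_apply']; exact continuous_rightPrimitive ih

/-- Cauchy's formula for repeated integration from the left. -/
theorem integral_sub_pow_mul_left (hf : Continuous f) (q : ℕ) (z : ℝ) :
    ∫ x in (-1 : ℝ)..z, (z - x) ^ q * f x = q.factorial * leftPrimitive^[q + 1] f z := by
  induction q generalizing f with
  | zero => simp [leftPrimitive]
  | succ q ih =>
    -- Integration by parts trades one power of `z - x` for one primitive of `f`; the boundary terms
    -- vanish because the power is zero at `z` and the primitive at `-1`.
    have h := intervalIntegral.integral_mul_deriv_eq_deriv_mul (a := -1) (b := z)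
      (u := fun x => (z - x) ^ (q + 1)) (u' := fun x => -((q + 1) * (z - x) ^ q))
      (v := leftPrimitive f) (v' := f)
      (fun x _ => by
        have := ((hasDerivAt_id x).const_sub z).fun_pow (q + 1)
        simpa [mul_comm] using this)
      (fun x _ => hasDerivAt_leftPrimitive hf x)
      (Continuous.intervalIntegrable (by fun_prop) _ _) (hf.intervalIntegrable _ _)
    have h0 : leftPrimitive f (-1) = 0 := intervalIntegral.integral_same
    rw [h, h0, sub_self, zero_pow (by omega), zero_mul, mul_zero, sub_zero, zero_sub,
      Function.iterate_succ_apply, Nat.factorial_succ, Nat.cast_mul, mul_assoc,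
      ← ih (continuous_leftPrimitive hf), ← intervalIntegral.integral_neg,
      ← intervalIntegral.integral_const_mul]
    congr 1
    ext x
    push_cast
    ring

/-- Cauchy's formula for repeated integration from the right. -/
theorem integral_sub_pow_mul_right (hf : Continuous f) (q : ℕ) (x : ℝ) :
    ∫ z in x..1, (z - x) ^ q * f z = q.factorial * rightPrimitive^[q + 1] f x := by
  induction q generalizing f with
  | zero => simp [rightPrimitive]
  | succ q ih =>
    have h := intervalIntegral.integral_mul_deriv_eq_deriv_mul (a := x) (b := 1)
      (u := fun z => (z - x) ^ (q + 1)) (u' := fun z => (q + 1) * (z - x) ^ q)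
      (v := rightPrimitive f) (v' := fun z => -f z)
      (fun z _ => by
        have := ((hasDerivAt_id z).sub_const x).fun_pow (q + 1)
        simpa [mul_comm] using this)
      (fun z _ => hasDerivAt_rightPrimitive hf z)
      (Continuous.intervalIntegrable (by fun_prop) _ _) (hf.neg.intervalIntegrable _ _)
    have h0 : rightPrimitive f 1 = 0 := intervalIntegral.integral_same
    simp only [mul_neg, intervalIntegral.integral_neg] at h
    rw [h0, sub_self, zero_pow (by omega), zero_mul, mul_zero, sub_zero, zero_sub, neg_inj] at h
    rw [h, Function.iterate_succ_apply, Nat.factorial_succ, Nat.cast_mul, mul_assoc,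
      ← ih (continuous_rightPrimitive hf), ← intervalIntegral.integral_const_mul]
    congr 1
    ext x
    push_cast
    ring

/-- The activation vanishes for `x ≥ z`; this uses `0 ^ p = 0`, hence `1 ≤ p`. -/
theorem reluTransform_eq_integral (hp : 1 ≤ p) (hf : Integrable f intervalMeasure) {z : ℝ}
    (hz : z ∈ Set.Icc (-1 : ℝ) 1) :
    reluTransform p f z = ∫ x in (-1 : ℝ)..z, (z - x) ^ p * f x := by
  have hc : Continuous fun x => reluPow p (z - x) := (continuous_reluPow p).comp (by fun_prop)
  have hi : IntegrableOn (fun x => reluPow p (z - x) * f x) (Set.Icc (-1) 1) :=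
    hc.integrable_mul_intervalMeasure hf
  rw [reluTransform, integral_intervalMeasure, ← intervalIntegral.integral_add_adjacent_intervals
    (b := z), intervalIntegral.integral_congr (g := fun x => (z - x) ^ p * f x),
    intervalIntegral.integral_congr (a := z) (b := 1) (g := fun _ => 0)]
  · simp
  · intro x hx
    rw [Set.uIcc_of_le hz.2] at hx
    simp only [reluPow]
    rw [max_eq_left (by linarith [hx.1]), zero_pow (by omega), zero_mul]
  · intro x hx
    rw [Set.uIcc_of_le hz.1] at hx
    simp only [reluPow]
    rw [max_eq_right (by linarith [hx.2])]
  · rw [intervalIntegrable_iff_integrableOn_Icc_of_le hz.1]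
    exact hi.mono_set (Set.Icc_subset_Icc le_rfl hz.2)
  · rw [intervalIntegrable_iff_integrableOn_Icc_of_le hz.2]
    exact hi.mono_set (Set.Icc_subset_Icc hz.1 le_rfl)

theorem reluCotransform_eq_integral (hp : 1 ≤ p) (hf : Integrable f intervalMeasure) {x : ℝ}
    (hx : x ∈ Set.Icc (-1 : ℝ) 1) :
    reluCotransform p f x = ∫ z in x..1, (z - x) ^ p * f z := by
  have hc : Continuous fun z => reluPow p (z - x) := (continuous_reluPow p).comp (by fun_prop)
  have hi : IntegrableOn (fun z => reluPow p (z - x) * f z) (Set.Icc (-1) 1) :=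
    hc.integrable_mul_intervalMeasure hf
  rw [reluCotransform, integral_intervalMeasure,
    ← intervalIntegral.integral_add_adjacent_intervals
    (b := x), intervalIntegral.integral_congr (a := x) (g := fun z => (z - x) ^ p * f z),
    intervalIntegral.integral_congr (a := -1) (b := x) (g := fun _ => 0)]
  · simp
  · intro z hz
    rw [Set.uIcc_of_le hx.1] at hz
    simp only [reluPow]
    rw [max_eq_left (by linarith [hz.2]), zero_pow (by omega), zero_mul]
  · intro z hz
    rw [Set.uIcc_of_le hx.2] at hz
    simp only [reluPow]
    rw [max_eq_right (by linarith [hz.1])]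
  · rw [intervalIntegrable_iff_integrableOn_Icc_of_le hx.1]
    exact hi.mono_set (Set.Icc_subset_Icc le_rfl hx.2)
  · rw [intervalIntegrable_iff_integrableOn_Icc_of_le hx.2]
    exact hi.mono_set (Set.Icc_subset_Icc hx.1 le_rfl)

theorem reluTransform_eq_iterate (hp : 1 ≤ p) (hf : Continuous f) {z : ℝ}
    (hz : z ∈ Set.Icc (-1 : ℝ) 1) :
    reluTransform p f z = p.factorial * leftPrimitive^[p + 1] f z := by
  rw [reluTransform_eq_integral hp hf.integrable_intervalMeasure hz, integral_sub_pow_mul_left hf]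

theorem reluCotransform_eq_iterate (hp : 1 ≤ p) (hf : Continuous f) {x : ℝ}
    (hx : x ∈ Set.Icc (-1 : ℝ) 1) :
    reluCotransform p f x = p.factorial * rightPrimitive^[p + 1] f x := by
  rw [reluCotransform_eq_integral hp hf.integrable_intervalMeasure hx,
    integral_sub_pow_mul_right hf]

end Primitive

/-! ### Injectivity of the transform -/

section Injectivity

variable {p : ℕ} {f φ : ℝ → ℝ}

/-- A test function and its derivatives vanish at `1`, so each integration undoes a derivative up to
sign. Hence every test function is, on `[-1, 1]`, a multiple of the cotransform of its derivative of
order `p + 1`. -/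
theorem rightPrimitive_iterate_iteratedDeriv (k : ℕ) (hφ : ContDiff ℝ (⊤ : ℕ∞) φ)
    (hsupp : tsupport φ ⊆ Set.Ioo (-1) 1) :
    rightPrimitive^[k] (iteratedDeriv k φ) = fun x => (-1) ^ k * φ x := by
  induction k generalizing φ with
  | zero => simp
  | succ k ih =>
    have hd : ContDiff ℝ (⊤ : ℕ∞) (deriv φ) := (contDiff_infty_iff_deriv.1 hφ).2
    have hdiff : Differentiable ℝ φ := (contDiff_infty_iff_deriv.1 hφ).1
    have h1 : φ 1 = 0 := image_eq_zero_of_notMem_tsupport fun h => lt_irrefl _ (hsupp h).2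
    rw [iteratedDeriv_succ', Function.iterate_succ_apply', ih hd
      ((tsupport_deriv_subset (𝕜 := ℝ)).trans hsupp)]
    ext x
    rw [rightPrimitive, intervalIntegral.integral_const_mul,
      intervalIntegral.integral_deriv_eq_sub (fun y _ => hdiff y)
        (hd.continuous.intervalIntegrable _ _), h1, pow_succ]
    ring

/-- The factor of the integral operator is injective. -/
theorem ae_eq_zero_of_reluTransform (hp : 1 ≤ p) (hf : Integrable f intervalMeasure)
    (h0 : reluTransform p f =ᵐ[intervalMeasure] 0) : f =ᵐ[intervalMeasure] 0 := by
  -- Moving the cotransform across the integral turns `∫ φ f` into a multiple of `∫ φ^(p+1) ·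
  -- reluTransform p f = 0`.
  have hae : ∀ᵐ x ∂intervalMeasure, x ∈ Set.Ioo (-1 : ℝ) 1 → f x = 0 := by
    refine isOpen_Ioo.ae_eq_zero_of_integral_contDiff_smul_eq_zero
      (hf.locallyIntegrable.locallyIntegrableOn _) fun φ hφ _ hsupp => ?_
    have hg : Continuous (iteratedDeriv (p + 1) φ) :=
      hφ.continuous_iteratedDeriv _ (by exact_mod_cast le_top)
    have hswap := integral_mul_reluCotransform (p := p) hg.integrable_intervalMeasure hf
    have hzero : ∫ z, iteratedDeriv (p + 1) φ z * reluTransform p f z ∂intervalMeasure = 0 := by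
      rw [integral_congr_ae (g := fun _ => 0), integral_zero]
      filter_upwards [h0] with z hz
      rw [hz, Pi.zero_apply, mul_zero]
    have hφW : ∫ x, f x * reluCotransform p (iteratedDeriv (p + 1) φ) x ∂intervalMeasure =
        (p.factorial * (-1) ^ (p + 1)) * ∫ x, φ x • f x ∂intervalMeasure := by
      rw [← integral_const_mul]
      refine integral_congr_ae ?_
      filter_upwards [ae_mem_Icc] with x hx
      rw [reluCotransform_eq_iterate hp hg hx, rightPrimitive_iterate_iteratedDeriv _ hφ hsupp,
        smul_eq_mul]
      ring
    rw [← hswap, hφW] at hzero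
    have hne : (p.factorial : ℝ) * (-1) ^ (p + 1) ≠ 0 :=
      mul_ne_zero (by exact_mod_cast p.factorial_ne_zero) (pow_ne_zero _ (by norm_num))
    exact (mul_eq_zero.1 hzero).resolve_left hne
  have hIoo : ∀ᵐ x ∂intervalMeasure, x ∈ Set.Ioo (-1 : ℝ) 1 := by
    rw [intervalMeasure, ← Measure.restrict_congr_set Ioo_ae_eq_Icc]
    exact ae_restrict_mem measurableSet_Ioo
  filter_upwards [hae, hIoo] with x hx hx' using hx hx'

end Injectivity

/-! ### Positivity and simplicity of the eigenvalues -/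

section Eigenvalues

open scoped InnerProductSpace

variable {p : ℕ} {c : ℝ} {v : L2Interval}

theorem inner_reluOperator_self_pos (hp : 1 ≤ p) (hv : v ≠ 0) : 0 < ⟪reluOperator p v, v⟫_ℝ := by
  have hc := continuous_reluTransform (p := p) (integrable_coeFn v)
  have hnn : 0 ≤ fun z => reluTransform p v z * reluTransform p v z := fun z => mul_self_nonneg _
  rw [inner_reluOperator]
  refine lt_of_le_of_ne (integral_nonneg hnn) fun h => hv ?_
  have h0 := (integral_eq_zero_iff_of_nonneg hnn (hc.mul hc).integrable_intervalMeasure).1 h.symm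
  rw [Lp.eq_zero_iff_ae_eq_zero]
  refine ae_eq_zero_of_reluTransform hp (integrable_coeFn v) ?_
  filter_upwards [h0] with z hz using mul_self_eq_zero.1 hz

theorem eigenvalue_reluOperator_pos (hp : 1 ≤ p)
    (hc : Module.End.HasEigenvalue (reluOperator p : L2Interval →ₗ[ℝ] L2Interval) c) : 0 < c := by
  obtain ⟨v, hv⟩ := hc.exists_hasEigenvector
  have h := inner_reluOperator_self_pos hp hv.2
  have hv' : reluOperator p v = c • v := hv.apply_eq_smul
  rw [hv', real_inner_smul_left] at h
  exact pos_of_mul_pos_left h real_inner_self_nonneg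

/-- A solution of the eigenvalue equation is determined by its transform at the endpoint `1`. -/
theorem eigenfunction_eq_zero {h : ℝ → ℝ} (hp : 1 ≤ p) (hc : c ≠ 0) (hcont : Continuous h)
    (heq : ∀ x ∈ Set.Icc (-1 : ℝ) 1, reluIntegral p h x = c * h x)
    (h1 : reluTransform p h 1 = 0) : ∀ x ∈ Set.Icc (-1 : ℝ) 1, h x = 0 := by
  set n := p + 1 with hn
  set G : ℝ → ℝ := fun z => p.factorial * leftPrimitive^[n] h z with hG
  have hGc : Continuous G := continuous_const.mul (continuous_leftPrimitive_iterate hcont n)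
  have hVG : ∀ z ∈ Set.Icc (-1 : ℝ) 1, reluTransform p h z = G z := fun z hz =>
    reluTransform_eq_iterate hp hcont hz
  have hK : ∀ x ∈ Set.Icc (-1 : ℝ) 1, c * h x = p.factorial * rightPrimitive^[n] G x := by
    intro x hx
    rw [← heq x hx, reluIntegral_eq_cotransform hcont.integrable_intervalMeasure,
      ← reluCotransform_eq_iterate hp hGc hx]
    refine integral_congr_ae ?_
    filter_upwards [ae_mem_Icc] with z hz
    rw [hVG z hz]
  -- The successive derivatives of `rightPrimitive^[n] G`: first the right primitives are removed,
  -- each with a sign, then the left primitives inside `G`. Both formulas agree at `j = n`.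
  let u : ℕ → ℝ → ℝ := fun j x => if j ≤ n then (-1) ^ j * rightPrimitive^[n - j] G x
    else (-1) ^ n * p.factorial * leftPrimitive^[2 * n - j] h x
  have hlow : ∀ j ≤ n, u j = fun x => (-1) ^ j * rightPrimitive^[n - j] G x := fun j hj => by
    simp only [u, hj, if_true]
  have hhigh : ∀ j, n ≤ j →
      u j = fun x => (-1) ^ n * p.factorial * leftPrimitive^[2 * n - j] h x := by
    intro j hj
    obtain rfl | hlt := hj.eq_or_lt
    · rw [hlow n le_rfl, Nat.sub_self, two_mul, Nat.add_sub_cancel]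
      simp only [hG, Function.iterate_zero, id, mul_assoc]
    · simp only [u, not_le.2 hlt, if_false]
  -- The constant comes from `u (2 * n) = (-1) ^ n * p! * h` and, on `[-1, 1]`, `h = c⁻¹ * p! * u
  -- 0`.
  have hu0 := eq_zero_of_clamped_free (u := u) (n := n)
    (c := (-1) ^ n * p.factorial * (c⁻¹ * p.factorial)) (by omega) ?_ ?_ ?_ ?_
  · intro x hx
    have := hu0 x hx
    rw [hlow 0 (by omega)] at this
    simp only [pow_zero, one_mul, Nat.sub_zero] at this
    have h2 := hK x hx
    rw [this, mul_zero] at h2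
    exact (mul_eq_zero.1 h2).resolve_left hc
  · intro j hj x
    obtain hlt | hge := lt_or_ge j n
    · obtain ⟨k, hk⟩ : ∃ k, n - j = k + 1 := ⟨n - j - 1, by omega⟩
      rw [hlow j hlt.le, hlow (j + 1) hlt, hk, show n - (j + 1) = k by omega]
      simp only [Function.iterate_succ_apply']
      have := (hasDerivAt_rightPrimitive (continuous_rightPrimitive_iterate hGc k) x).const_mul
        ((-1 : ℝ) ^ j)
      refine this.congr_deriv ?_
      rw [pow_succ]
      ring
    · obtain ⟨k, hk⟩ : ∃ k, 2 * n - j = k + 1 := ⟨2 * n - j - 1, by omega⟩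
      rw [hhigh j hge, hhigh (j + 1) (by omega), hk, show 2 * n - (j + 1) = k by omega]
      simp only [Function.iterate_succ_apply']
      exact (hasDerivAt_leftPrimitive (continuous_leftPrimitive_iterate hcont k) x).const_mul _
  · intro x hx
    rw [hhigh (2 * n) (by omega), hlow 0 (by omega)]
    simp only [Nat.sub_self, Function.iterate_zero, id, pow_zero, one_mul, Nat.sub_zero]
    rw [mul_assoc _ (c⁻¹ * _), mul_assoc c⁻¹, ← hK x hx, inv_mul_cancel_left₀ hc]
  · intro j hj
    obtain hlt | rfl := hj.lt_or_eq
    · obtain ⟨k, hk⟩ : ∃ k, n - j = k + 1 := ⟨n - j - 1, by omega⟩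
      rw [hlow j hlt.le, hk]
      simp only [Function.iterate_succ_apply']
      rw [rightPrimitive, intervalIntegral.integral_same, mul_zero]
    -- The additional boundary condition at `j = n` is exactly `h1`.
    · rw [hlow n le_rfl]
      simp only [Nat.sub_self, Function.iterate_zero, id]
      rw [← hVG 1 (by norm_num), h1, mul_zero]
  · intro j hj hj'
    obtain ⟨k, hk⟩ : ∃ k, 2 * n - j = k + 1 := ⟨2 * n - j - 1, by omega⟩
    rw [hhigh j hj, hk]
    simp only [Function.iterate_succ_apply']
    rw [leftPrimitive, intervalIntegral.integral_same, mul_zero]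

theorem eigenvector_eq_zero_of_reluTransform (hp : 1 ≤ p) (hc : c ≠ 0)
    (hv : reluOperator p v = c • v) (h1 : reluTransform p v 1 = 0) : v = 0 := by
  -- A continuous representative of `v`, for which the eigenvalue equation holds at every point.
  set h : ℝ → ℝ := fun x => c⁻¹ * reluIntegral p v x with hh
  have hcont : Continuous h := continuous_const.mul (continuous_reluIntegral (integrable_coeFn v))
  have hae : v =ᵐ[intervalMeasure] h := by
    have h2 := coeFn_reluOperator p v
    rw [hv] at h2
    filter_upwards [h2, Lp.coeFn_smul c v] with x hx hx'
    rw [hx', Pi.smul_apply, smul_eq_mul] at hx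
    rw [hh, ← inv_mul_cancel_left₀ hc (v x), hx]
    rfl
  have hzero := eigenfunction_eq_zero hp hc hcont (fun x hx => ?_) ?_
  · rw [Lp.eq_zero_iff_ae_eq_zero]
    filter_upwards [hae, ae_mem_Icc] with x hx hx'
    rw [hx, hzero x hx', Pi.zero_apply]
  · rw [hh, mul_inv_cancel_left₀ hc, reluIntegral_eq, reluIntegral_eq]
    refine integral_congr_ae ?_
    filter_upwards [hae] with y hy
    rw [hy]
  · rw [← h1]
    refine integral_congr_ae ?_
    filter_upwards [hae] with y hy
    rw [hy]

theorem inner_toLp_eq_integral {g : ℝ → ℝ} (hg : MemLp g 2 intervalMeasure) (v : L2Interval) :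
    ⟪hg.toLp g, v⟫_ℝ = ∫ x, g x * v x ∂intervalMeasure := by
  rw [L2.inner_def]
  refine integral_congr_ae ?_
  filter_upwards [hg.coeFn_toLp] with x hx
  rw [hx]
  simp [mul_comm]

theorem Continuous.memLp_intervalMeasure {g : ℝ → ℝ} (hg : Continuous g) :
    MemLp g 2 intervalMeasure := by
  obtain ⟨M, hM⟩ := isCompact_Icc.exists_bound_of_continuousOn
    (hg.continuousOn (s := Set.Icc (-1 : ℝ) 1))
  refine MemLp.of_bound hg.aestronglyMeasurable M ?_
  filter_upwards [ae_mem_Icc] with y hy using hM y hy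

/-- Every eigenspace of the integral operator is a line. -/
theorem finrank_eigenspace_reluOperator (hp : 1 ≤ p)
    (hc : Module.End.HasEigenvalue (reluOperator p : L2Interval →ₗ[ℝ] L2Interval) c) :
    Module.finrank ℝ
      (Module.End.eigenspace (reluOperator p : L2Interval →ₗ[ℝ] L2Interval) c) = 1 := by
  have hc0 := (eigenvalue_reluOperator_pos hp hc).ne'
  have hr : MemLp (fun x => reluPow p (1 - x)) 2 intervalMeasure :=
    ((continuous_reluPow p).comp (by fun_prop)).memLp_intervalMeasure
  -- `L` is `v ↦ reluTransform p v 1`, written as an inner product with `x ↦ reluPow p (1 - x)`.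
  let L : Module.End.eigenspace (reluOperator p : L2Interval →ₗ[ℝ] L2Interval) c →ₗ[ℝ] ℝ :=
    (innerₛₗ ℝ (hr.toLp _)).comp (Submodule.subtype _)
  have hL : Function.Injective L := by
    rw [injective_iff_map_eq_zero]
    intro v hv
    have hv' : ⟪hr.toLp _, (v : L2Interval)⟫_ℝ = 0 := hv
    rw [inner_toLp_eq_integral] at hv'
    exact Subtype.ext (eigenvector_eq_zero_of_reluTransform hp hc0
      (Module.End.mem_eigenspace_iff.1 v.2) hv')
  have hfin := Module.Finite.of_injective L hL
  have hle := LinearMap.finrank_le_finrank_of_injective hL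
  rw [Module.finrank_self] at hle
  exact le_antisymm hle (Submodule.one_le_finrank_iff.2 hc)

end Eigenvalues

/-! ### Functions with vanishing moments on a uniform partition -/

/-- The `i`-th node of the partition of `[-1, 1]` into `N` intervals of equal length. -/
noncomputable def uniformNode (N i : ℕ) : ℝ := -1 + i * (2 / N)

section Partition

variable {p N i : ℕ} {f : ℝ → ℝ}

theorem uniformNode_zero (N : ℕ) : uniformNode N 0 = -1 := by simp [uniformNode]

theorem uniformNode_self (hN : 0 < N) : uniformNode N N = 1 := by
  have : (N : ℝ) ≠ 0 := by exact_mod_cast hN.ne'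
  rw [uniformNode]
  field_simp
  norm_num

theorem uniformNode_succ_sub (N i : ℕ) : uniformNode N (i + 1) - uniformNode N i = 2 / N := by
  simp only [uniformNode]
  push_cast
  ring

theorem uniformNode_le_succ (N i : ℕ) : uniformNode N i ≤ uniformNode N (i + 1) := by
  have : (0 : ℝ) ≤ 2 / N := by positivity
  linarith [uniformNode_succ_sub N i]

theorem uniformNode_mono (N : ℕ) : Monotone (uniformNode N) :=
  monotone_nat_of_le_succ (uniformNode_le_succ N)

theorem uniformNode_mem_Icc (hN : 0 < N) (hi : i ≤ N) : uniformNode N i ∈ Set.Icc (-1 : ℝ) 1 := by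
  rw [← uniformNode_zero N, ← uniformNode_self hN]
  exact ⟨uniformNode_mono N (Nat.zero_le i), uniformNode_mono N hi⟩

theorem intervalIntegrable_of_intervalMeasure (hf : Integrable f intervalMeasure) {a b : ℝ}
    (ha : a ∈ Set.Icc (-1 : ℝ) 1) (hb : b ∈ Set.Icc (-1 : ℝ) 1) :
    IntervalIntegrable f volume a b := by
  rw [intervalIntegrable_iff]
  refine IntegrableOn.mono_set (t := Set.Icc (-1) 1) hf (Set.uIoc_subset_uIcc.trans ?_)
  exact Set.uIcc_subset_Icc ha hb

theorem sum_integral_uniformNode (hN : 0 < N) (hf : Integrable f intervalMeasure) :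
    ∑ i ∈ Finset.range N, ∫ x in uniformNode N i..uniformNode N (i + 1), f x =
      ∫ x in (-1 : ℝ)..1, f x := by
  rw [intervalIntegral.sum_integral_adjacent_intervals, uniformNode_zero, uniformNode_self hN]
  exact fun k hk => intervalIntegrable_of_intervalMeasure hf (uniformNode_mem_Icc hN hk.le)
    (uniformNode_mem_Icc hN hk)

/-- Vanishing of the moments of degree at most `p` on every piece of the uniform partition. -/
def HasZeroMoments (p N : ℕ) (f : ℝ → ℝ) : Prop :=
  ∀ i < N, ∀ j ≤ p, ∫ x in uniformNode N i..uniformNode N (i + 1), x ^ j * f x = 0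

/-- As a function of `x`, `(z - x) ^ p` is a polynomial of degree `p`, so complete pieces contribute
nothing. -/
theorem HasZeroMoments.integral_sub_pow (hm : HasZeroMoments p N f) (hN : 0 < N)
    (hf : Integrable f intervalMeasure) (z : ℝ) (hi : i ≤ N) :
    ∫ x in (-1 : ℝ)..uniformNode N i, (z - x) ^ p * f x = 0 := by
  have hint : Integrable (fun x => (z - x) ^ p * f x) intervalMeasure :=
    Continuous.integrable_mul_intervalMeasure (by fun_prop) hf
  induction i with
  | zero => rw [uniformNode_zero, intervalIntegral.integral_same]
  | succ i ih =>
    have h0 := uniformNode_mem_Icc hN (i := i) (by omega)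
    have h1 := uniformNode_mem_Icc hN hi
    rw [← intervalIntegral.integral_add_adjacent_intervals
      (intervalIntegrable_of_intervalMeasure hint (by norm_num) h0)
      (intervalIntegrable_of_intervalMeasure hint h0 h1), ih (by omega), zero_add]
    have hexp : ∀ x, (z - x) ^ p * f x = ∑ j ∈ Finset.range (p + 1),
        ((-1) ^ j * z ^ (p - j) * p.choose j) * (x ^ j * f x) := by
      intro x
      rw [show z - x = -x + z by ring, add_pow, Finset.sum_mul]
      refine Finset.sum_congr rfl fun j _ => ?_
      rw [neg_pow]
      ring
    simp only [hexp]
    rw [intervalIntegral.integral_finsetSum]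
    · refine Finset.sum_eq_zero fun j hj => ?_
      rw [intervalIntegral.integral_const_mul, hm i hi j (by simpa [Nat.lt_succ_iff] using hj),
        mul_zero]
    · intro j _
      exact (intervalIntegrable_of_intervalMeasure
        (Continuous.integrable_mul_intervalMeasure (by fun_prop) hf) h0 h1).const_mul _

/-- Only the piece containing `z` contributes, and there `z - x` is at most its length `2 / N`. -/
theorem HasZeroMoments.abs_reluTransform_le (hp : 1 ≤ p) (hm : HasZeroMoments p N f)
    (hf : Integrable f intervalMeasure) (hi : i < N) {z : ℝ}
    (hz : z ∈ Set.Icc (uniformNode N i) (uniformNode N (i + 1))) :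
    |reluTransform p f z| ≤
      (2 / N) ^ p * ∫ x in uniformNode N i..uniformNode N (i + 1), |f x| := by
  have hN : 0 < N := by omega
  have h0 := uniformNode_mem_Icc hN hi.le
  have h1 := uniformNode_mem_Icc hN (i := i + 1) hi
  have hz' : z ∈ Set.Icc (-1 : ℝ) 1 := ⟨h0.1.trans hz.1, hz.2.trans h1.2⟩
  have hint : Integrable (fun x => (z - x) ^ p * f x) intervalMeasure :=
    Continuous.integrable_mul_intervalMeasure (by fun_prop) hf
  rw [reluTransform_eq_integral hp hf hz', ← intervalIntegral.integral_add_adjacent_intervals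
      (intervalIntegrable_of_intervalMeasure hint (by norm_num) h0)
      (intervalIntegrable_of_intervalMeasure hint h0 hz'), hm.integral_sub_pow hN hf z hi.le,
      zero_add]
  have habs : IntervalIntegrable (fun x => |f x|) volume (uniformNode N i) z :=
    intervalIntegrable_of_intervalMeasure hf.abs h0 hz'
  have hd := uniformNode_succ_sub N i
  calc |∫ x in uniformNode N i..z, (z - x) ^ p * f x|
      ≤ ∫ x in uniformNode N i..z, (2 / N) ^ p * |f x| := by
        rw [← Real.norm_eq_abs]
        refine intervalIntegral.norm_integral_le_of_norm_le hz.1 (ae_of_all _ fun x hx => ?_)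
          (habs.const_mul _)
        rw [Real.norm_eq_abs, abs_mul, abs_pow, abs_of_nonneg (by linarith [hx.2] : 0 ≤ z - x)]
        exact mul_le_mul_of_nonneg_right (pow_le_pow_left₀ (by linarith [hx.2])
          (by linarith [hx.1, hz.2]) _) (abs_nonneg _)
    _ = (2 / N) ^ p * ∫ x in uniformNode N i..z, |f x| := intervalIntegral.integral_const_mul _ _
    _ ≤ _ := by
        refine mul_le_mul_of_nonneg_left ?_ (by positivity)
        exact intervalIntegral.integral_mono_interval le_rfl hz.1 hz.2
          (ae_of_all _ fun x => abs_nonneg _)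
          (intervalIntegrable_of_intervalMeasure hf.abs h0 h1)

/-- The Cauchy-Schwarz inequality against a constant on an interval. -/
theorem sq_integral_le {g : ℝ → ℝ} {a b : ℝ} (hab : a < b) (hg : IntervalIntegrable g volume a b)
    (hg2 : IntervalIntegrable (fun x => g x ^ 2) volume a b) :
    (∫ x in a..b, g x) ^ 2 ≤ (b - a) * ∫ x in a..b, g x ^ 2 := by
  set I := ∫ x in a..b, g x
  have hδ : 0 < b - a := sub_pos.2 hab
  have h0 : 0 ≤ ∫ x in a..b, (g x - I / (b - a)) ^ 2 :=
    intervalIntegral.integral_nonneg hab.le fun x _ => sq_nonneg _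
  have h1 : ∫ x in a..b, (g x - I / (b - a)) ^ 2 =
      (∫ x in a..b, g x ^ 2) - 2 * (I / (b - a)) * I + (I / (b - a)) ^ 2 * (b - a) := by
    have he : ∀ x, (g x - I / (b - a)) ^ 2 =
        (g x ^ 2 - 2 * (I / (b - a)) * g x) + (I / (b - a)) ^ 2 := fun x => by ring
    simp only [he]
    rw [intervalIntegral.integral_add (hg2.sub (hg.const_mul _)) intervalIntegrable_const,
      intervalIntegral.integral_sub hg2 (hg.const_mul _), intervalIntegral.integral_const_mul,
      intervalIntegral.integral_const, smul_eq_mul]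
    ring
  rw [h1] at h0
  have h2 : (∫ x in a..b, g x ^ 2) - 2 * (I / (b - a)) * I + (I / (b - a)) ^ 2 * (b - a) =
      (∫ x in a..b, g x ^ 2) - I ^ 2 / (b - a) := by
    field_simp
    ring
  rw [h2, sub_nonneg, div_le_iff₀ hδ] at h0
  linarith

/-- Squaring the pointwise bound gives `2p` factors `2 / N`; integrating over a piece and the
Cauchy-Schwarz inequality give one more each. -/
theorem HasZeroMoments.integral_sq_reluTransform_le (hp : 1 ≤ p) (hm : HasZeroMoments p N f)
    (hN : 0 < N) (hf : Integrable f intervalMeasure)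
    (hf2 : Integrable (fun x => f x ^ 2) intervalMeasure) :
    ∫ z, reluTransform p f z ^ 2 ∂intervalMeasure ≤
      (2 / N) ^ (2 * p + 2) * ∫ x, f x ^ 2 ∂intervalMeasure := by
  have hc : Continuous fun z => reluTransform p f z ^ 2 := (continuous_reluTransform hf).pow 2
  rw [integral_intervalMeasure, integral_intervalMeasure,
    ← sum_integral_uniformNode hN hc.integrable_intervalMeasure,
    ← sum_integral_uniformNode hN hf2, Finset.mul_sum]
  refine Finset.sum_le_sum fun i hi => ?_
  have hi := Finset.mem_range.1 hi
  have h0 := uniformNode_mem_Icc hN hi.le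
  have h1 := uniformNode_mem_Icc hN (i := i + 1) hi
  have hd := uniformNode_succ_sub N i
  have hδ : (0 : ℝ) < 2 / N := by positivity
  have hlt : uniformNode N i < uniformNode N (i + 1) := by linarith
  set I := ∫ x in uniformNode N i..uniformNode N (i + 1), |f x| with hI
  have hcs : I ^ 2 ≤ (2 / N) * ∫ x in uniformNode N i..uniformNode N (i + 1), f x ^ 2 := by
    have := sq_integral_le hlt (intervalIntegrable_of_intervalMeasure hf.abs h0 h1)
      (by simpa only [sq_abs] using intervalIntegrable_of_intervalMeasure hf2 h0 h1)
    simpa only [sq_abs, hd] using this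
  calc ∫ z in uniformNode N i..uniformNode N (i + 1), reluTransform p f z ^ 2
      ≤ ∫ z in uniformNode N i..uniformNode N (i + 1), ((2 / N) ^ p * I) ^ 2 := by
        refine intervalIntegral.integral_mono_on hlt.le (hc.intervalIntegrable _ _)
          intervalIntegrable_const fun z hz => ?_
        rw [← sq_abs (reluTransform p f z)]
        exact pow_le_pow_left₀ (abs_nonneg _) (hm.abs_reluTransform_le hp hf hi hz) 2
    _ = (2 / N) ^ (2 * p + 1) * I ^ 2 := by
        rw [intervalIntegral.integral_const, smul_eq_mul, hd]
        ring
    _ ≤ (2 / N) ^ (2 * p + 1) *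
        ((2 / N) * ∫ x in uniformNode N i..uniformNode N (i + 1), f x ^ 2) :=
        mul_le_mul_of_nonneg_left hcs (by positivity)
    _ = _ := by ring

end Partition

/-! ### Compactness and eigenvalue counting -/

section Moments

open scoped InnerProductSpace

variable {p N : ℕ} {v : L2Interval}

theorem memLp_indicator_pow (N i j : ℕ) :
    MemLp ((Set.Ioc (uniformNode N i) (uniformNode N (i + 1))).indicator fun x => x ^ j) 2
      intervalMeasure :=
  (Continuous.memLp_intervalMeasure (by fun_prop)).indicator measurableSet_Ioc

/-- The monomial of degree `j ≤ p` cut off to the `i`-th of `N` intervals. -/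
noncomputable def momentVector (p N : ℕ) (q : Fin N × Fin (p + 1)) : L2Interval :=
  (memLp_indicator_pow N q.1 q.2).toLp _

theorem hasZeroMoments_of_inner (hN : 0 < N) (h : ∀ q, ⟪momentVector p N q, v⟫_ℝ = 0) :
    HasZeroMoments p N v := by
  intro i hi j hj
  have h0 := uniformNode_mem_Icc hN hi.le
  have h1 := uniformNode_mem_Icc hN (i := i + 1) hi
  have := h (⟨i, hi⟩, ⟨j, Nat.lt_succ_of_le hj⟩)
  rw [momentVector, inner_toLp_eq_integral] at this
  simp only [← Set.indicator_mul_left] at this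
  rw [integral_indicator measurableSet_Ioc,
    Measure.restrict_restrict measurableSet_Ioc, Set.inter_eq_left.2] at this
  · rwa [intervalIntegral.integral_of_le (uniformNode_le_succ N i)]
  · exact Set.Ioc_subset_Icc_self.trans (Set.Icc_subset_Icc h0.1 h1.2)

theorem inner_reluOperator_self_le (hp : 1 ≤ p) (hN : 0 < N)
    (h : ∀ q, ⟪momentVector p N q, v⟫_ℝ = 0) :
    ⟪reluOperator p v, v⟫_ℝ ≤ (2 / N) ^ (2 * p + 2) * ‖v‖ ^ 2 := by
  have h1 := (hasZeroMoments_of_inner hN h).integral_sq_reluTransform_le hp hN (integrable_coeFn v)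
    (Lp.memLp v).integrable_sq
  have h2 : ‖v‖ ^ 2 = ∫ x, v x ^ 2 ∂intervalMeasure := by
    rw [← real_inner_self_eq_norm_sq, L2.inner_def]
    simp [sq]
  rw [inner_reluOperator, h2]
  simpa only [sq] using h1

theorem sq_inner_reluOperator_le (p : ℕ) (f g : L2Interval) :
    ⟪reluOperator p f, g⟫_ℝ ^ 2 ≤ ⟪reluOperator p f, f⟫_ℝ * ⟪reluOperator p g, g⟫_ℝ := by
  have hm (f : L2Interval) : MemLp (reluTransform p f) 2 intervalMeasure :=
    (continuous_reluTransform (integrable_coeFn f)).memLp_intervalMeasure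
  have hi (f g : L2Interval) :
      ⟪reluOperator p f, g⟫_ℝ = ⟪(hm f).toLp (reluTransform p f), (hm g).toLp _⟫_ℝ := by
    rw [inner_toLp_eq_integral, inner_reluOperator]
    refine integral_congr_ae ?_
    filter_upwards [(hm g).coeFn_toLp] with x hx
    rw [hx]
  rw [hi, hi, hi, sq]
  exact real_inner_mul_inner_self_le _ _

/-- Passes from the quadratic form to the norm: the Cauchy-Schwarz inequality for the form with `g =
K v` gives `‖K v‖⁴ ≤ ⟪K v, v⟫ ‖K‖ ‖K v‖²`. The exponent is halved, which is still enough for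
compactness. -/
theorem norm_reluOperator_le (hp : 1 ≤ p) (hN : 0 < N)
    (h : ∀ q, ⟪momentVector p N q, v⟫_ℝ = 0) :
    ‖reluOperator p v‖ ≤ (2 / N) ^ (p + 1) * √‖reluOperator p‖ * ‖v‖ := by
  set K := reluOperator p
  have h1 := inner_reluOperator_self_le hp hN h
  have h2 := sq_inner_reluOperator_le p v (K v)
  have h3 : ⟪K (K v), K v⟫_ℝ ≤ ‖K‖ * ‖K v‖ ^ 2 :=
    calc ⟪K (K v), K v⟫_ℝ ≤ ‖K (K v)‖ * ‖K v‖ := real_inner_le_norm _ _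
      _ ≤ ‖K‖ * ‖K v‖ * ‖K v‖ := mul_le_mul_of_nonneg_right (K.le_opNorm _) (norm_nonneg _)
      _ = _ := by ring
  rw [real_inner_self_eq_norm_sq] at h2
  have hr : 0 ≤ (2 / N : ℝ) ^ (p + 1) * √‖K‖ * ‖v‖ := by positivity
  refine abs_le_of_sq_le_sq' ?_ hr |>.2
  have hsq : ((2 / N : ℝ) ^ (p + 1) * √‖K‖ * ‖v‖) ^ 2 =
      (2 / N) ^ (2 * p + 2) * ‖v‖ ^ 2 * ‖K‖ := by
    rw [mul_pow, mul_pow, Real.sq_sqrt (norm_nonneg _)]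
    ring
  rw [hsq]
  obtain h0 | hpos := (sq_nonneg ‖K v‖).eq_or_lt
  · rw [← h0]; positivity
  · have h4 : (‖K v‖ ^ 2) ^ 2 ≤ (2 / N) ^ (2 * p + 2) * ‖v‖ ^ 2 * (‖K‖ * ‖K v‖ ^ 2) :=
      h2.trans ((mul_le_mul_of_nonneg_left h3 (by
        rw [inner_reluOperator]
        exact integral_nonneg fun z => mul_self_nonneg _)).trans
        (mul_le_mul_of_nonneg_right h1 (by positivity)))
    rw [sq (‖K v‖ ^ 2), ← mul_assoc] at h4
    exact le_of_mul_le_mul_right h4 hpos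

theorem isCompactOperator_reluOperator (hp : 1 ≤ p) : IsCompactOperator (reluOperator p) := by
  let W : ℕ → Submodule ℝ L2Interval := fun N =>
    Submodule.span ℝ (Set.range (momentVector p (N + 1)))
  have hW (N : ℕ) : FiniteDimensional ℝ (W N) :=
    FiniteDimensional.span_of_finite ℝ (Set.finite_range _)
  -- The approximants have finite rank, and `v` minus its projection has zero moments, so the
  -- previous bound applies to the difference.
  refine isCompactOperator_of_tendsto (l := atTop)
    (F := fun N => reluOperator p ∘L (W N).starProjection) ?_ ?_
  · have hlim : Tendsto (fun N : ℕ => (2 / ((N + 1 : ℕ) : ℝ)) ^ (p + 1) * √‖reluOperator p‖) atTop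
        (nhds 0) := by
      have h1 : Tendsto (fun N : ℕ => 2 / ((N + 1 : ℕ) : ℝ)) atTop (nhds 0) :=
        (tendsto_const_div_atTop_nhds_zero_nat 2).comp (tendsto_add_atTop_nat 1)
      simpa using (h1.pow (p + 1)).mul_const (√‖reluOperator p‖)
    rw [tendsto_iff_norm_sub_tendsto_zero]
    refine squeeze_zero (fun _ => norm_nonneg _) (fun N => ?_) hlim
    refine ContinuousLinearMap.opNorm_le_bound _ (by positivity) fun v => ?_
    have horth : ∀ q, ⟪momentVector p (N + 1) q, v - (W N).starProjection v⟫_ℝ = 0 := fun q =>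
      (Submodule.sub_starProjection_mem_orthogonal v) _ (Submodule.subset_span ⟨q, rfl⟩)
    have hb := norm_reluOperator_le hp (Nat.succ_pos N) horth
    have hv : ‖v - (W N).starProjection v‖ ≤ ‖v‖ := by
      have := Submodule.norm_sq_eq_add_norm_sq_starProjection v (W N)
      rw [Submodule.starProjection_orthogonal_val] at this
      nlinarith [norm_nonneg v, sq_nonneg ‖(W N).starProjection v‖]
    rw [sub_apply, ContinuousLinearMap.comp_apply, ← map_sub, ← norm_neg,
      ← map_neg, neg_sub]
    exact hb.trans (mul_le_mul_of_nonneg_left hv (by positivity))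
  · refine Eventually.of_forall fun N => ?_
    have : IsCompactOperator (W N).starProjection :=
      (isCompactOperator_of_locallyCompactSpace_rng (W N).subtypeL).comp_clm
        (W N).orthogonalProjectionOnto
    exact this.clm_comp (reluOperator p)

/-- More than `(p + 1) N` eigenvalues cannot all exceed `(2 / N) ^ (2p + 2)`. -/
theorem le_of_card_eigenvalues (hp : 1 ≤ p) (hN : 0 < N) {ε : ℝ} (s : Finset ℝ)
    (hs : ∀ c ∈ s, Module.End.HasEigenvalue (reluOperator p : L2Interval →ₗ[ℝ] L2Interval) c)
    (hε : ∀ c ∈ s, ε ≤ c) (hcard : (p + 1) * N < s.card) : ε ≤ (2 / N) ^ (2 * p + 2) := by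
  have hex : ∀ c : s, ∃ e : L2Interval, ‖e‖ = 1 ∧ reluOperator p e = (c : ℝ) • e := by
    intro c
    obtain ⟨v, hv⟩ := (hs c c.2).exists_hasEigenvector
    refine ⟨‖v‖⁻¹ • v, norm_smul_inv_norm hv.2, ?_⟩
    have hv' : reluOperator p v = (c : ℝ) • v := hv.apply_eq_smul
    rw [map_smul, hv', smul_comm]
  choose e he1 heK using hex
  have horth : Orthonormal ℝ e := by
    refine ⟨he1, fun c d hcd => ?_⟩
    have h := isSymmetric_reluOperator p (e c) (e d)
    rw [ContinuousLinearMap.coe_coe, heK, heK, real_inner_smul_left, real_inner_smul_right] at h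
    have h2 : ((c : ℝ) - d) * ⟪e c, e d⟫_ℝ = 0 := by linarith
    exact (mul_eq_zero.1 h2).resolve_left (sub_ne_zero.2 fun h => hcd (Subtype.ext h))
  -- There are more eigenvectors than moments, so some nontrivial combination has all moments zero;
  -- its Rayleigh quotient is at least `ε`.
  let T : (s → ℝ) →ₗ[ℝ] (Fin N × Fin (p + 1) → ℝ) :=
    LinearMap.pi fun q => (innerₛₗ ℝ (momentVector p N q)).comp (Fintype.linearCombination ℝ e)
  have hker : T.ker ≠ ⊥ := by
    refine LinearMap.ker_ne_bot_of_finrank_lt ?_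
    simp only [Module.finrank_fintype_fun_eq_card, Fintype.card_prod, Fintype.card_fin,
      Fintype.card_coe]
    rwa [mul_comm]
  obtain ⟨a, ha, hane⟩ := (Submodule.ne_bot_iff _).1 hker
  set v : L2Interval := ∑ c, a c • e c with hv
  have hzero : ∀ q, ⟪momentVector p N q, v⟫_ℝ = 0 := fun q => congrFun (LinearMap.mem_ker.1 ha) q
  have hle := inner_reluOperator_self_le hp hN hzero
  have hKv : reluOperator p v = ∑ c : s, (a c * (c : ℝ)) • e c := by
    rw [hv, map_sum]
    refine Finset.sum_congr rfl fun c _ => ?_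
    rw [map_smul, heK, smul_smul]
  have hnorm : ‖v‖ ^ 2 = ∑ c, a c ^ 2 := by
    rw [← real_inner_self_eq_norm_sq, hv, horth.inner_sum]
    simp [sq]
  have hinner : ⟪reluOperator p v, v⟫_ℝ = ∑ c : s, a c * c * a c := by
    rw [hKv, hv, horth.inner_sum]
    simp
  have hpos : 0 < ‖v‖ ^ 2 := by
    obtain ⟨c, hc⟩ := Function.ne_iff.1 hane
    rw [hnorm]
    exact Finset.sum_pos' (fun _ _ => sq_nonneg _) ⟨c, Finset.mem_univ _, by
      have : a c ≠ 0 := hc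
      positivity⟩
  have hge : ε * ‖v‖ ^ 2 ≤ ⟪reluOperator p v, v⟫_ℝ := by
    rw [hinner, hnorm, Finset.mul_sum]
    refine Finset.sum_le_sum fun c _ => ?_
    nlinarith [hε c c.2, sq_nonneg (a c)]
  exact le_of_mul_le_mul_right (hge.trans hle) hpos

end Moments

/-! ### Enumeration and decay of the infinite spectrum -/

/-- An infinite set of reals whose intersection with every `[ε, ∞)`, `ε > 0`, is finite and all of
whose elements are positive is the range of a strictly decreasing sequence. -/
theorem Set.Infinite.exists_strictAnti_range_eq {E : Set ℝ} (hE : E.Infinite)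
    (hpos : ∀ c ∈ E, 0 < c) (hfin : ∀ ε > 0, (E ∩ Set.Ici ε).Finite) :
    ∃ μ : ℕ → ℝ, StrictAnti μ ∧ E = Set.range μ := by
  -- The rank of `c` is the number of larger elements. Enumerating the set of ranks with `Nat.nth`
  -- avoids proving that every natural number is a rank.
  set r : ℝ → ℕ := fun c => (E ∩ Set.Ioi c).ncard with hr
  have hf : ∀ c ∈ E, (E ∩ Set.Ioi c).Finite := fun c hc =>
    (hfin c (hpos c hc)).subset fun x hx => ⟨hx.1, Set.Ioi_subset_Ici_self hx.2⟩
  have hanti : ∀ c ∈ E, ∀ d ∈ E, c < d → r d < r c := fun c hc d hd hcd =>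
    Set.ncard_lt_ncard ⟨fun x hx => ⟨hx.1, hcd.trans hx.2⟩,
      fun h => lt_irrefl d (h ⟨hd, hcd⟩).2⟩ (hf c hc)
  have hinj : Set.InjOn r E := by
    intro c hc d hd h
    by_contra hne
    obtain hlt | hlt := lt_or_gt_of_ne hne
    · exact (hanti c hc d hd hlt).ne' h
    · exact (hanti d hd c hc hlt).ne h
  have hR : {k | k ∈ r '' E}.Infinite := hE.image hinj
  have hex : ∀ k, ∃ c ∈ E, r c = Nat.nth (fun k => k ∈ r '' E) k := fun k =>
    Nat.nth_mem_of_infinite hR k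
  choose μ hμE hμ using hex
  refine ⟨μ, fun j k hjk => ?_, Set.Subset.antisymm (fun c hc => ?_) ?_⟩
  · have h1 : r (μ j) < r (μ k) := by
      rw [hμ, hμ]
      exact Nat.nth_strictMono hR hjk
    by_contra! hle
    obtain h | h := hle.eq_or_lt
    · rw [h] at h1
      exact lt_irrefl _ h1
    · exact lt_asymm h1 (hanti _ (hμE j) _ (hμE k) h)
  · have : r c ∈ Set.range (Nat.nth fun k => k ∈ r '' E) := by
      rw [Nat.range_nth_of_infinite hR]
      exact ⟨c, hc, rfl⟩
    obtain ⟨k, hk⟩ := this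
    exact ⟨k, hinj (hμE k) hc ((hμ k).trans hk)⟩
  · rintro _ ⟨k, rfl⟩
    exact hμE k

open scoped InnerProductSpace in
theorem not_finiteDimensional_L2Interval : ¬ FiniteDimensional ℝ L2Interval := by
  intro _
  set N := Module.finrank ℝ L2Interval + 1 with hN
  have hN0 : 0 < N := Nat.succ_pos _
  let e : Fin N → L2Interval := fun i => indicatorConstLp 2
    (measurableSet_Ioc (a := uniformNode N i) (b := uniformNode N (i + 1)))
    (measure_ne_top intervalMeasure _) (1 : ℝ)
  have hinner (i j : Fin N) : ⟪e i, e j⟫_ℝ = intervalMeasure.real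
      (Set.Ioc (uniformNode N i) (uniformNode N (i + 1)) ∩
        Set.Ioc (uniformNode N j) (uniformNode N (j + 1))) :=
    L2.real_inner_indicatorConstLp_one_indicatorConstLp_one _ _ _ _
  have hli : LinearIndependent ℝ e := by
    refine linearIndependent_of_ne_zero_of_inner_eq_zero (𝕜 := ℝ) (fun i h => ?_) fun i j hij => ?_
    · have h1 := hinner i i
      have hsub : Set.Ioc (uniformNode N i) (uniformNode N (i + 1)) ⊆ Set.Icc (-1) 1 :=
        Set.Ioc_subset_Icc_self.trans (Set.Icc_subset_Icc (uniformNode_mem_Icc hN0 i.2.le).1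
          (uniformNode_mem_Icc hN0 i.2).2)
      rw [h, inner_zero_left, Set.inter_self, measureReal_restrict_apply measurableSet_Ioc,
        Set.inter_eq_left.2 hsub, Real.volume_real_Ioc_of_le (uniformNode_le_succ N i),
        uniformNode_succ_sub] at h1
      have : (0 : ℝ) < 2 / N := by positivity
      exact this.ne h1
    · have hd : Disjoint (Set.Ioc (uniformNode N i) (uniformNode N (i + 1)))
          (Set.Ioc (uniformNode N j) (uniformNode N (j + 1))) :=
        (uniformNode_mono N).pairwise_disjoint_on_Ioc_succ fun h => hij (Fin.ext h)
      change ⟪e i, e j⟫_ℝ = 0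
      rw [hinner, hd.inter_eq, measureReal_empty]
  have := hli.fintype_card_le_finrank
  rw [Fintype.card_fin] at this
  omega

section Spectrum

variable {p : ℕ}

/-- By the spectral theorem the eigenspaces span a dense subspace; finitely many of them, each
finite-dimensional, would make the whole space finite-dimensional. -/
theorem infinite_eigenvalues_reluOperator (hp : 1 ≤ p) :
    {c : ℝ |
      Module.End.HasEigenvalue (reluOperator p : L2Interval →ₗ[ℝ] L2Interval) c}.Infinite := by
  intro hfin
  set K : Module.End ℝ L2Interval := (reluOperator p : L2Interval →ₗ[ℝ] L2Interval)
  have hle : (⨆ c, Module.End.eigenspace K c) ≤ hfin.toFinset.sup (Module.End.eigenspace K) := by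
    refine iSup_le fun c => ?_
    by_cases hc : Module.End.HasEigenvalue K c
    · exact Finset.le_sup (f := Module.End.eigenspace K) (hfin.mem_toFinset.2 hc)
    · rw [Module.End.hasEigenvalue_iff, not_not] at hc
      rw [hc]
      exact bot_le
  have hsup : FiniteDimensional ℝ
      (hfin.toFinset.sup (Module.End.eigenspace K) : Submodule ℝ L2Interval) := by
    refine Finset.sup_induction (p := fun S : Submodule ℝ L2Interval => FiniteDimensional ℝ S)
      (by infer_instance) (fun S hS T hT => Submodule.finiteDimensional_sup S T) fun c hc => ?_
    have hc' : Module.End.HasEigenvalue K c := hfin.mem_toFinset.1 hc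
    exact ContinuousLinearMap.finite_dimensional_eigenspace (isCompactOperator_reluOperator hp) c
      (eigenvalue_reluOperator_pos hp hc').ne'
  have hiSup := Submodule.finiteDimensional_of_le hle
  have hbot := ContinuousLinearMap.orthogonalComplement_iSup_eigenspaces_eq_bot
    (isCompactOperator_reluOperator hp) (isSymmetric_reluOperator p)
  rw [Submodule.orthogonal_eq_bot_iff] at hbot
  rw [hbot] at hiSup
  exact not_finiteDimensional_L2Interval (Submodule.topEquiv.finiteDimensional)

theorem finite_eigenvalues_reluOperator_Ici (hp : 1 ≤ p) {ε : ℝ} (hε : 0 < ε) :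
    ({c : ℝ | Module.End.HasEigenvalue (reluOperator p : L2Interval →ₗ[ℝ] L2Interval) c} ∩
      Set.Ici ε).Finite := by
  by_contra hinf
  have hlim : Tendsto (fun N : ℕ => (2 / (N : ℝ)) ^ (2 * p + 2)) atTop (nhds 0) := by
    simpa using (tendsto_const_div_atTop_nhds_zero_nat (2 : ℝ)).pow (2 * p + 2)
  obtain ⟨N, hN, hN0⟩ := ((hlim.eventually (gt_mem_nhds hε)).and (eventually_gt_atTop 0)).exists
  obtain ⟨s, hs, hcard⟩ := Set.Infinite.exists_subset_card_eq hinf ((p + 1) * N + 1)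
  exact absurd (le_of_card_eigenvalues hp hN0 s (fun c hc => (hs hc).1) (fun c hc => (hs hc).2)
    (by omega)) (not_le.2 hN)

theorem isBigO_eigenvalues (hp : 1 ≤ p) {μ : ℕ → ℝ} (hμ : StrictAnti μ) (hpos : ∀ k, 0 < μ k)
    (heig : ∀ k,
      Module.End.HasEigenvalue (reluOperator p : L2Interval →ₗ[ℝ] L2Interval) (μ k)) :
    μ =O[atTop] (fun k : ℕ => ((k : ℝ) + 1) ^ (-(2 * (p : ℤ) + 2))) := by
  -- With `N = ⌊k / (p + 1)⌋` and `k ≥ p + 1` one has `k + 1 ≤ 2 (p + 1) N`, so `2 / N ≤ 4 (p + 1) /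
  -- (k + 1)`. Counting from `0`, the values up to `μ k` are `k + 1 > (p + 1) N` eigenvalues.
  refine Asymptotics.IsBigO.of_bound ((4 * (p + 1)) ^ (2 * p + 2)) ?_
  filter_upwards [eventually_ge_atTop (p + 1)] with k hk
  set N := k / (p + 1) with hN
  have hN0 : 0 < N := Nat.div_pos hk (Nat.succ_pos p)
  have hle := le_of_card_eigenvalues hp hN0 (ε := μ k) ((Finset.range (k + 1)).image μ)
    (by
      intro c hc
      obtain ⟨j, -, rfl⟩ := Finset.mem_image.1 hc
      exact heig j)
    (by
      intro c hc
      obtain ⟨j, hj, rfl⟩ := Finset.mem_image.1 hc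
      exact hμ.antitone (Nat.lt_succ_iff.1 (Finset.mem_range.1 hj)))
    (by
      rw [Finset.card_image_of_injective _ hμ.injective, Finset.card_range]
      exact Nat.lt_succ_of_le (Nat.mul_div_le k (p + 1)))
  have hk1 : (k : ℝ) + 1 ≤ 2 * (p + 1) * N := by
    have h1 : k < (p + 1) * (N + 1) := Nat.lt_mul_div_succ k (Nat.succ_pos p)
    have h2 : k + 1 ≤ 2 * (p + 1) * N := by nlinarith
    exact_mod_cast h2
  have hN0' : (0 : ℝ) < N := by exact_mod_cast hN0
  have hdiv : (2 : ℝ) / N ≤ 4 * (p + 1) / (k + 1) := by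
    rw [div_le_div_iff₀ hN0' (by positivity)]
    linarith
  rw [Real.norm_of_nonneg (hpos k).le, Real.norm_of_nonneg (by positivity), zpow_neg,
    show (2 * (p : ℤ) + 2) = ((2 * p + 2 : ℕ) : ℤ) by push_cast; ring, zpow_natCast,
    ← div_eq_mul_inv, ← div_pow]
  exact hle.trans (pow_le_pow_left₀ (by positivity) hdiv _)

end Spectrum

theorem mainTheorem4 (p : ℕ) (hp : 1 ≤ p) :
    IsCompactOperator (reluOperator p) ∧
    ∃ μ : ℕ → ℝ,
      StrictAnti μ ∧
      (∀ k, 0 < μ k) ∧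
      {c : ℝ | Module.End.HasEigenvalue (reluOperator p : L2Interval →ₗ[ℝ] L2Interval) c} =
        Set.range μ ∧
      (∀ k, Module.finrank ℝ
        (Module.End.eigenspace (reluOperator p : L2Interval →ₗ[ℝ] L2Interval) (μ k)) = 1) ∧
      μ =O[atTop] (fun k : ℕ => ((k : ℝ) + 1) ^ (-(2 * (p : ℤ) + 2))) := by
  obtain ⟨μ, hμ, hrange⟩ := (infinite_eigenvalues_reluOperator hp).exists_strictAnti_range_eq
    (fun c hc => eigenvalue_reluOperator_pos hp hc)
    (fun ε hε => finite_eigenvalues_reluOperator_Ici hp hε)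
  have heig : ∀ k,
      Module.End.HasEigenvalue (reluOperator p : L2Interval →ₗ[ℝ] L2Interval) (μ k) := fun k =>
    (Set.ext_iff.1 hrange (μ k)).2 ⟨k, rfl⟩
  have hpos : ∀ k, 0 < μ k := fun k => eigenvalue_reluOperator_pos hp (heig k)
  exact ⟨isCompactOperator_reluOperator hp, μ, hμ, hpos, hrange,
    fun k => finrank_eigenspace_reluOperator hp (heig k), isBigO_eigenvalues hp hμ hpos heig⟩
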